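/- Let $S_1,S_2,S_3:\mathbb R^2\to\mathbb R^2$ be the similarities $S_i(x)=\frac13x+\frac23v_i$ with $v_1=(0,0)$, $v_2=(1,0)$, $v_3=(\frac12,\frac{\sqrt3}2)$, and let $P$ (the R-measure) be the unique Borel probability measure on $\mathbb R^2$ with $P=\frac13\sum_{j=1}^3P\circ S_j^{-1}$. Put $I=\{1,2,3\}$ and, for a word $\omega=\omega_1\cdots\omega_k\in I^k$, $S_\omega=S_{\omega_1}\circ\cdots\circ S_{\omega_k}$ and $\triangle_\omega=S_\omega(\triangle)$, where $\triangle$ is the closed triangle with vertices $v_1,v_2,v_3$; let $a(\omega)=\frac1{P(\triangle_\omega)}\int_{\triangle_\omega}x\,dP(x)$. For $n\ge1$ let $$V_n=\inf\Big\{\int\min_{a\in\alpha}\|x-a\|^2\,dP(x):\ \emptyset\ne\alpha\subset\mathbb R^2,\ \operatorname{card}(\alpha)\le n\Big\},$$ where $\|\cdot\|$ is the Euclidean norm; a set $\alpha$ at which the infimum is achieved is called an optimal set of $n$-means. Let $n\ge3$, and let $\ell=\ell(n)$ be the unique natural number with $3^{\ell}\le n<3^{\ell+1}$. 1. If $n=3^\ell$,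 then $\{a(\omega):\omega\in I^\ell\}$ is the unique optimal set of $n$-means. 2. If $3^\ell<n\le2\cdot3^\ell$, then every set of the form $$\{a(\omega):\omega\in I^\ell\setminus J\}\cup\bigcup_{\omega\in J}S_\omega(\alpha_2^{(\omega)}),\qquad J\subset I^\ell,\ \operatorname{card}(J)=n-3^\ell,$$ where each $\alpha_2^{(\omega)}$ is an optimal set of two-means (chosen separately for each $\omega\in J$), is an optimal set of $n$-means, and the number of sets of this form is $\binom{3^\ell}{n-3^\ell}\,3^{\,n-3^\ell}$. 3. If $2\cdot3^\ell<n<3^{\ell+1}$, then every set of the form $$\bigcup_{\omega\in J}S_\omega(\alpha_3^{(\omega)})\cup\bigcup_{\omega\in I^\ell\setminus J}S_\omega(\alpha_2^{(\omega)}),\qquad J\subset I^\ell,\ \operatorname{card}(J)=n-2\cdot3^\ell,$$ where each $\alpha_3^{(\omega)}$ is an optimal set of three-means and each $\alpha_2^{(\omega)}$ is an optimal set of two-means (chosen separately for each $\omega$), is an optimal set of $n$-means, and the number of sets of this form is $\binom{3^\ell}{n-2\cdot3^\ell}\,3^{\,3^{\ell+1}-n}$. In all three cases $$V_n=\frac12\cdot\frac1{27^{\ell+1}}\,\big(13\cdot3^\ell-4n\big).$$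 -/

import Mathlib

open MeasureTheory Set
open scoped ENNReal NNReal Topology

/-- The Euclidean plane. -/
abbrev Plane : Type := EuclideanSpace ℝ (Fin 2)

namespace RTriangle

noncomputable section

/-! ### The iterated function system

The alphabet `{1, 2, 3}` is represented by `Fin 3` (the symbols are `0, 1, 2`), and words of
length `k` by `Fin k → Fin 3`. -/

/-- The vertices `(0, 0)`, `(1, 0)`, `(1/2, √3/2)` of the basic equilateral triangle. -/
def vertex : Fin 3 → Plane :=
  ![!₂[0, 0], !₂[1, 0], !₂[1 / 2, Real.sqrt 3 / 2]]

/-- The similarity `x ↦ x / 3 + (2 / 3) v` fixing the `i`-th vertex `v`. -/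
def simMap (i : Fin 3) (x : Plane) : Plane :=
  (1 / 3 : ℝ) • x + (2 / 3 : ℝ) • vertex i

/-- Words of length `k`. -/
abbrev Word (k : ℕ) : Type := Fin k → Fin 3

/-- `S_ω = S_{ω₁} ∘ ⋯ ∘ S_{ω_k}`, the identity for the empty word. -/
def wordMap {k : ℕ} (ω : Word k) (x : Plane) : Plane :=
  (List.ofFn ω).foldr simMap x

/-- The closed equilateral triangle `△`. -/
def triangle : Set Plane := convexHull ℝ (range vertex)

/-- The triangle `△_ω = S_ω(△)`. -/
def cell {k : ℕ} (ω : Word k) : Set Plane := wordMap ω '' triangle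

/-! ### The R-measure -/

/-- `P` satisfies `P = (1/3) ∑ⱼ P ∘ Sⱼ⁻¹`. -/
def SelfSimilar (P : Measure Plane) : Prop :=
  P = (3 : ℝ≥0∞)⁻¹ • ∑ j : Fin 3, P.map (simMap j)

/-- The uniform distribution on the alphabet. -/
def letterMeasure : Measure (Fin 3) := (3 : ℝ≥0∞)⁻¹ • ∑ j : Fin 3, Measure.dirac j

/-- The point `lim_k S_{σ₁} ∘ ⋯ ∘ S_{σ_k} (0) = ∑_k (2 / 3 ^ k) v_{σ_k}` of the limit set that is
addressed by the infinite word `σ`. -/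
def address (σ : ℕ → Fin 3) : Plane :=
  ∑' k : ℕ, ((2 / 3 : ℝ) * (1 / 3) ^ k) • vertex (σ k)

/-- The R-measure: the distribution of the address of an infinite word whose letters are
independent and uniformly distributed. By `rMeasure_selfSimilar` and `eq_rMeasure` below it is
the unique Borel probability measure `P` with `P = (1/3) ∑ⱼ P ∘ Sⱼ⁻¹`. -/
def rMeasure : Measure Plane :=
  (Measure.infinitePi fun _ : ℕ => letterMeasure).map address

instance : IsProbabilityMeasure letterMeasure where
  measure_univ := by
    simp [letterMeasure, ENNReal.inv_mul_cancel]

theorem norm_vertex_le (i : Fin 3) : ‖vertex i‖ ≤ 1 := by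
  have h3 : Real.sqrt 3 ^ 2 = 3 := Real.sq_sqrt (by norm_num)
  fin_cases i <;> simp [vertex, EuclideanSpace.norm_eq, Fin.sum_univ_two]
  rw [div_pow, h3]; norm_num

theorem norm_term_le (k : ℕ) (i : Fin 3) :
    ‖((2 / 3 : ℝ) * (1 / 3) ^ k) • vertex i‖ ≤ (2 / 3 : ℝ) * (1 / 3) ^ k := by
  rw [norm_smul, Real.norm_of_nonneg (by positivity)]
  exact mul_le_of_le_one_right (by positivity) (norm_vertex_le i)

theorem summable_bound : Summable fun k : ℕ => (2 / 3 : ℝ) * (1 / 3) ^ k :=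
  (summable_geometric_of_lt_one (by norm_num) (by norm_num)).mul_left _

theorem measurable_address : Measurable address := by
  have : Continuous address := by
    refine continuous_tsum (fun k => ?_) summable_bound (fun k σ => norm_term_le k (σ k))
    have hv : Continuous fun σ : ℕ → Fin 3 => vertex (σ k) :=
      (continuous_of_discreteTopology (f := vertex)).comp
        (continuous_apply (A := fun _ : ℕ => Fin 3) k)
    exact hv.const_smul ((2 / 3 : ℝ) * (1 / 3) ^ k)
  exact this.measurable

/-- Prepend a letter to an infinite word. -/
def prepend (i : Fin 3) (σ : ℕ → Fin 3) : ℕ → Fin 3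
  | 0 => i
  | k + 1 => σ k

theorem measurable_prepend (i : Fin 3) : Measurable (prepend i) := by
  refine measurable_pi_lambda _ fun k => ?_
  cases k with
  | zero => exact measurable_const
  | succ k => exact measurable_pi_apply k

theorem measurable_simMap (i : Fin 3) : Measurable (simMap i) := by
  unfold simMap; fun_prop

theorem address_prepend (i : Fin 3) (σ : ℕ → Fin 3) :
    address (prepend i σ) = simMap i (address σ) := by
  have hs : ∀ τ : ℕ → Fin 3,
      Summable fun k : ℕ => ((2 / 3 : ℝ) * (1 / 3) ^ k) • vertex (τ k) := fun τ =>
    Summable.of_norm_bounded summable_bound fun k => norm_term_le k (τ k)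
  unfold address simMap
  rw [(hs _).tsum_eq_zero_add, ← (hs σ).tsum_const_smul, add_comm]
  congr 1
  · refine tsum_congr fun k => ?_
    simp only [prepend, smul_smul]
    congr 1
    ring
  · simp [prepend]

theorem infinitePi_selfSimilar :
    (Measure.infinitePi fun _ : ℕ => letterMeasure) = (3 : ℝ≥0∞)⁻¹ •
      ∑ j : Fin 3, (Measure.infinitePi fun _ : ℕ => letterMeasure).map (prepend j) := by
  classical
  symm
  refine Measure.eq_infinitePi _ fun s t ht => ?_
  obtain ⟨N, hN⟩ : ∃ N, s ⊆ Finset.range (N + 1) :=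
    ⟨s.sup id, fun i hi => Finset.mem_range.2 (Nat.lt_succ_of_le (Finset.le_sup (f := id) hi))⟩
  set u : ℕ → Set (Fin 3) := fun i => if i ∈ s then t i else univ with hu
  have hum : ∀ i, MeasurableSet (u i) := fun i => MeasurableSet.of_discrete
  have hbox : Set.pi (s : Set ℕ) t = Set.pi (Finset.range (N + 1) : Set ℕ) u := by
    ext σ
    simp only [Set.mem_pi, Finset.mem_coe, hu]
    constructor
    · intro h i _
      by_cases hi : i ∈ s
      · simpa [hi] using h i hi
      · simp [hi]
    · intro h i hi
      simpa [hi] using h i (hN hi)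
  have hprod : ∏ i ∈ s, letterMeasure (t i) = ∏ i ∈ Finset.range (N + 1), letterMeasure (u i) := by
    rw [← Finset.prod_subset hN (f := fun i => letterMeasure (u i))]
    · exact Finset.prod_congr rfl fun i hi => by simp [hu, hi]
    · intro i _ hi
      simp [hu, hi]
  have hpre : ∀ j : Fin 3, prepend j ⁻¹' Set.pi (Finset.range (N + 1) : Set ℕ) u =
      if j ∈ u 0 then Set.pi (Finset.range N : Set ℕ) (fun i => u (i + 1)) else ∅ := by
    intro j
    ext σ
    by_cases hj : j ∈ u 0
    · simp only [hj, if_true, mem_preimage, Set.mem_pi, Finset.mem_coe, Finset.mem_range]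
      constructor
      · intro h i hi
        exact h (i + 1) (by omega)
      · intro h i hi
        cases i with
        | zero => exact hj
        | succ i => exact h i (by omega)
    · simp only [hj, if_false, mem_preimage, Set.mem_pi, Finset.mem_coe, Finset.mem_range,
        mem_empty_iff_false, iff_false]
      intro h
      exact hj (h 0 (by omega))
  have hmeas : MeasurableSet (Set.pi (Finset.range (N + 1) : Set ℕ) u) :=
    MeasurableSet.pi (Finset.countable_toSet _) fun i _ => hum i
  rw [hbox, hprod, Finset.prod_range_succ']
  have hval : ∀ j : Fin 3, (Measure.infinitePi fun _ : ℕ => letterMeasure).map (prepend j)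
      (Set.pi (Finset.range (N + 1) : Set ℕ) u) =
      (∏ i ∈ Finset.range N, letterMeasure (u (i + 1))) * Measure.dirac j (u 0) := by
    intro j
    rw [Measure.map_apply (measurable_prepend j) hmeas, hpre j]
    by_cases hj : j ∈ u 0
    · rw [if_pos hj, Measure.infinitePi_pi _ fun i _ => hum _]
      simp [hj]
    · rw [if_neg hj]
      simp [hj]
  simp only [Measure.smul_apply, Measure.finsetSum_apply, hval, smul_eq_mul]
  rw [← Finset.mul_sum]
  have : letterMeasure (u 0) = (3 : ℝ≥0∞)⁻¹ * ∑ j : Fin 3, Measure.dirac j (u 0) := by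
    simp [letterMeasure]
  rw [this]
  ring

instance : IsProbabilityMeasure rMeasure :=
  Measure.isProbabilityMeasure_map measurable_address.aemeasurable

/-- The R-measure satisfies its defining equation. -/
theorem rMeasure_selfSimilar : SelfSimilar rMeasure := by
  unfold SelfSimilar
  have h : ∀ j : Fin 3, rMeasure.map (simMap j) =
      ((Measure.infinitePi fun _ : ℕ => letterMeasure).map (prepend j)).map address := by
    intro j
    rw [rMeasure, Measure.map_map (measurable_simMap j) measurable_address,
      Measure.map_map measurable_address (measurable_prepend j)]
    congr 1
    funext σ
    exact (address_prepend j σ).symm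
  simp only [h]
  conv_lhs => rw [rMeasure, infinitePi_selfSimilar]
  rw [Measure.map_smul, Measure.map_finset_sum]
  exact measurable_address.aemeasurable

theorem charFun_selfSimilar {P : Measure Plane} [IsProbabilityMeasure P] (hP : SelfSimilar P)
    (t : Plane) :
    charFun P t = (3 : ℂ)⁻¹ * (∑ j : Fin 3,
      Complex.exp (inner ℝ ((2 / 3 : ℝ) • vertex j) t * Complex.I)) *
        charFun P ((1 / 3 : ℝ) • t) := by
  have hj : ∀ j : Fin 3, charFun (P.map (simMap j)) t =
      Complex.exp (inner ℝ ((2 / 3 : ℝ) • vertex j) t * Complex.I) *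
        charFun P ((1 / 3 : ℝ) • t) := by
    intro j
    have : P.map (simMap j) = (P.map fun x => (1 / 3 : ℝ) • x).map
        fun x => x + (2 / 3 : ℝ) • vertex j := by
      rw [Measure.map_map (by fun_prop) (by fun_prop)]
      rfl
    rw [this, charFun_map_add_const, charFun_map_smul, mul_comm]
  have hint : ∀ j : Fin 3, Integrable (fun x => Complex.exp (inner ℝ x t * Complex.I))
      (P.map (simMap j)) := by
    intro j
    have := Measure.isProbabilityMeasure_map (μ := P) (measurable_simMap j).aemeasurable
    refine Integrable.of_bound (C := 1) (by fun_prop) (ae_of_all _ fun x => ?_)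
    rw [Complex.norm_exp_ofReal_mul_I]
  conv_lhs => rw [hP]
  rw [charFun_apply, integral_smul_measure, integral_finsetSum_measure fun j _ => hint j]
  simp only [← charFun_apply, hj, ← Finset.sum_mul]
  simp [mul_assoc]

/-- There is only one Borel probability measure with `P = (1/3) ∑ⱼ P ∘ Sⱼ⁻¹`. -/
theorem eq_rMeasure {P : Measure Plane} [IsProbabilityMeasure P] (hP : SelfSimilar P) :
    P = rMeasure := by
  refine Measure.ext_of_charFun (funext fun t => ?_)
  have step : ∀ s : Plane, ‖charFun P s - charFun rMeasure s‖ ≤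
      ‖charFun P ((1 / 3 : ℝ) • s) - charFun rMeasure ((1 / 3 : ℝ) • s)‖ := by
    intro s
    rw [charFun_selfSimilar hP s, charFun_selfSimilar rMeasure_selfSimilar s, ← mul_sub, norm_mul]
    refine mul_le_of_le_one_left (norm_nonneg _) ?_
    rw [norm_mul]
    have := norm_sum_le (Finset.univ : Finset (Fin 3)) fun j =>
      Complex.exp (inner ℝ ((2 / 3 : ℝ) • vertex j) s * Complex.I)
    simp only [Complex.norm_exp_ofReal_mul_I, Finset.sum_const, Finset.card_univ,
      Fintype.card_fin, nsmul_eq_mul, mul_one] at this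
    have h3 : ‖(3 : ℂ)⁻¹‖ = 1 / 3 := by simp
    rw [h3]
    push_cast at this
    linarith
  have iter : ∀ k : ℕ, ‖charFun P t - charFun rMeasure t‖ ≤
      ‖charFun P ((1 / 3 : ℝ) ^ k • t) - charFun rMeasure ((1 / 3 : ℝ) ^ k • t)‖ := by
    intro k
    induction k with
    | zero => simp
    | succ k ih =>
      refine ih.trans ((step _).trans_eq ?_)
      rw [smul_smul, ← pow_succ']
  have hlim : Filter.Tendsto (fun k : ℕ => (1 / 3 : ℝ) ^ k • t) Filter.atTop (𝓝 0) := by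
    have := (tendsto_pow_atTop_nhds_zero_of_lt_one (r := (1 / 3 : ℝ)) (by norm_num)
      (by norm_num)).smul_const t
    simpa using this
  have hcont : ∀ (Q : Measure Plane) [IsProbabilityMeasure Q], Continuous (charFun Q) := by
    intro Q _
    exact continuous_charFun
  have hzero : Filter.Tendsto (fun k : ℕ =>
      ‖charFun P ((1 / 3 : ℝ) ^ k • t) - charFun rMeasure ((1 / 3 : ℝ) ^ k • t)‖)
      Filter.atTop (𝓝 0) := by
    have := (((hcont P).tendsto 0).comp hlim).sub (((hcont rMeasure).tendsto 0).comp hlim)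
    simpa using this.norm
  have := ge_of_tendsto hzero (Filter.Eventually.of_forall iter)
  exact sub_eq_zero.1 (norm_le_zero_iff.1 this)

/-! ### Quantization -/

/-- The distortion error `∫ min_{a ∈ α} ‖x - a‖² dP(x)` of a finite nonempty set `α`. -/
def distortion (P : Measure Plane) (α : Set Plane) : ℝ :=
  ∫ x, ⨅ a : α, ‖x - (a : Plane)‖ ^ 2 ∂P

/-- The `n`-th quantization error
`V_n(P) = inf {∫ min_{a ∈ α} ‖x - a‖² dP(x) : α ≠ ∅, card α ≤ n}`. -/
def quantError (P : Measure Plane) (n : ℕ) : ℝ :=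
  sInf {v : ℝ | ∃ α : Set Plane, α.Nonempty ∧ α.encard ≤ n ∧ v = distortion P α}

/-- `α` is an optimal set of `n`-means for `P`: it has at most `n` points and the infimum defining
`V_n(P)` is achieved at `α`. -/
def IsOptimalSet (P : Measure Plane) (n : ℕ) (α : Set Plane) : Prop :=
  α.Nonempty ∧ α.encard ≤ n ∧ distortion P α = quantError P n

/-- `a(ω) = E(X | X ∈ △_ω) = P(△_ω)⁻¹ ∫_{△_ω} x dP(x)`, where `X` has the R-measure `P` as its
distribution. -/
def centroid {k : ℕ} (ω : Word k) : Plane := ⨍ x in cell ω, x ∂rMeasure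

/-- The set `{a(ω) : ω ∈ I^ℓ \ J} ∪ ⋃_{ω ∈ J} S_ω(β_ω)`; here `β_ω` is the set of two-means that
is used in the cell `ω`. -/
def lowerSet {ℓ : ℕ} (J : Finset (Word ℓ)) (β : Word ℓ → Set Plane) : Set Plane :=
  {x | ∃ ω, ω ∉ J ∧ x = centroid ω} ∪ ⋃ ω ∈ J, wordMap ω '' β ω

/-- The set `⋃_{ω ∈ J} S_ω(γ_ω) ∪ ⋃_{ω ∈ I^ℓ \ J} S_ω(β_ω)`; here `γ_ω` is the set of three-means
and `β_ω` the set of two-means that is used in the cell `ω`. -/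
def upperSet {ℓ : ℕ} (J : Finset (Word ℓ)) (γ β : Word ℓ → Set Plane) : Set Plane :=
  (⋃ ω ∈ J, wordMap ω '' γ ω) ∪ ⋃ (ω : Word ℓ) (_ : ω ∉ J), wordMap ω '' β ω

/-- All sets `α_n(J)` for `3 ^ ℓ < n ≤ 2 * 3 ^ ℓ`: `J` is any set of `n - 3 ^ ℓ` words of length
`ℓ`, and an optimal set of two-means is chosen for each `ω ∈ J`. -/
def lowerFamily (ℓ n : ℕ) : Set (Set Plane) :=
  {α | ∃ (J : Finset (Word ℓ)) (β : Word ℓ → Set Plane), J.card = n - 3 ^ ℓ ∧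
    (∀ ω ∈ J, IsOptimalSet rMeasure 2 (β ω)) ∧ α = lowerSet J β}

/-- All sets `α_n(J)` for `2 * 3 ^ ℓ < n < 3 ^ (ℓ + 1)`: `J` is any set of `n - 2 * 3 ^ ℓ` words of
length `ℓ`, an optimal set of three-means is chosen for each `ω ∈ J` and an optimal set of
two-means for each `ω ∉ J`. -/
def upperFamily (ℓ n : ℕ) : Set (Set Plane) :=
  {α | ∃ (J : Finset (Word ℓ)) (γ β : Word ℓ → Set Plane), J.card = n - 2 * 3 ^ ℓ ∧
    (∀ ω ∈ J, IsOptimalSet rMeasure 3 (γ ω)) ∧ (∀ ω, ω ∉ J → IsOptimalSet rMeasure 2 (β ω)) ∧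
    α = upperSet J γ β}

end

end RTriangle

/-!
The lower bound for the quantization error is an instance of linear programming duality. Let `c` be
the centroid of `△`. For any function `u` and any finite set `α`,
`min_{a ∈ α} ‖x - a‖² ≥ u(x) - ∑_{a ∈ α} (u(x) - ‖x - a‖²)⁺`,
so the distortion error of `α` is at least the mean of the potential `u` minus the sum of the
*gains* `∫ (u(x) - ‖x - a‖²)⁺ dP(x)` of the points. The potential `u(x) = ‖x - c‖² + 2 / 27` works
for `n ≤ 3`: its mean is `13 / 54` and the gain of every point is at most `2 / 27`
(`gain_zero_lt_or`), which gives `V_n ≥ (13 - 4 n) / 54`. For larger `n` the potential is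
transported to the cells of level `ℓ` by the similarities, which yields the bound `errorBound ℓ n`
(`potentialMean_sub_sum_gain_le`, `errorBound_le_distortion`), equal to the asserted value of `V_n`.

With this choice of `u` the function `h(x) = u(x) - ‖x - a‖²` is affine, and since
`h⁺ = (h + |h|) / 2` the bound for the gain says that `∫ |h| dP ≤ 2 / 27 + ‖a - c‖²`. The
variance of the distribution of the three first level centroids in any direction is `2 / 27`, so
that the inequality is the Cauchy-Schwarz inequality for the means of `h` over the three cells as long as `h`
has no sign change inside a cell; a sign change inside a cell makes these means so unequal that the
loss is compensated (`sq_sum_lt_or_eq`). Equality holds only for the seven centroids of unions of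
first level cells (`IsCellMean`).

At level `ℓ ≥ 1` the gain of a point is the sum of the rescaled gains of its three preimages. These
are at distance `2` from each other. If two of them have positive gain, which happens only for
`ℓ = 1`, then the sum is still below the maximal gain (`sum_gain_zero_expand`, `sum_gain_expand`).

The sets of the theorem meet the bound by self-similarity (`isOptimalSet_glue`). For `n = 3 ^ ℓ` the
bounds of levels `ℓ - 1` and `ℓ` agree, so every point of an optimal set has maximal gain at both
levels, which leaves only the points `S_ω(c)` (`isOptimalSet_pow_iff`). Optimal sets of two-means
are pairs of the seven points for which the duality gap vanishes at the vertices of `△`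
(`isOptimalSet_two_iff`); there are three of them, and counting becomes a matter of counting
functions on words because the cells are disjoint (`ncard_glueFamily`).
-/

namespace RTriangle

noncomputable section

/-! ### Geometry of the triangle -/

/-- The centroid of the triangle `△`, which is also the mean of the R-measure. -/
def center : Plane := !₂[1 / 2, Real.sqrt 3 / 6]

/-- The vector from the centroid of `△` to its `j`-th vertex. -/
def arm (j : Fin 3) : Plane := vertex j - center

theorem vertex_eq (j : Fin 3) : vertex j = center + arm j := by
  simp [arm]

theorem inner_arm (i j : Fin 3) :
    inner ℝ (arm i) (arm j) = if i = j then (1 / 3 : ℝ) else -1 / 6 := by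
  have h3 : Real.sqrt 3 ^ 2 = 3 := Real.sq_sqrt (by norm_num)
  have h (x y : Plane) : inner ℝ x y = x 0 * y 0 + x 1 * y 1 := by
    simp [PiLp.inner_apply, Fin.sum_univ_two, mul_comm]
  rw [h]
  fin_cases i <;> fin_cases j <;> simp [arm, vertex, center] <;> ring_nf <;>
    (try rw [h3]) <;> norm_num

theorem norm_arm_sq (j : Fin 3) : ‖arm j‖ ^ 2 = 1 / 3 := by
  rw [← real_inner_self_eq_norm_sq, inner_arm]; simp

theorem sum_arm : arm 0 + arm 1 + arm 2 = 0 := by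
  ext i
  fin_cases i <;> simp [arm, vertex, center] <;> ring

theorem sum_inner_arm (a : Plane) :
    inner ℝ (arm 0) a + inner ℝ (arm 1) a + inner ℝ (arm 2) a = 0 := by
  rw [← inner_add_left, ← inner_add_left, sum_arm, inner_zero_left]

/-- The three arms form a tight frame of the plane. -/
theorem sum_inner_arm_sq (a : Plane) :
    inner ℝ (arm 0) a ^ 2 + inner ℝ (arm 1) a ^ 2 + inner ℝ (arm 2) a ^ 2 = ‖a‖ ^ 2 / 2 := by
  have h3 : Real.sqrt 3 ^ 2 = 3 := Real.sq_sqrt (by norm_num)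
  rw [EuclideanSpace.real_norm_sq_eq]
  simp [arm, vertex, center, PiLp.inner_apply, Fin.sum_univ_two]
  ring_nf
  rw [h3]
  ring

/-- `√3 / 3`, the circumradius of the triangle `△`. -/
def circumradius : ℝ := Real.sqrt 3 / 3

theorem circumradius_sq : circumradius ^ 2 = 1 / 3 := by
  rw [circumradius, div_pow, Real.sq_sqrt (by norm_num)]; norm_num

theorem circumradius_pos : 0 < circumradius := by
  unfold circumradius; positivity

theorem norm_arm (j : Fin 3) : ‖arm j‖ = circumradius := by
  rw [← sq_eq_sq₀ (norm_nonneg _) circumradius_pos.le, norm_arm_sq, circumradius_sq]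

theorem abs_inner_arm_le (j : Fin 3) (a : Plane) :
    |inner ℝ (arm j) a| ≤ circumradius * ‖a‖ := by
  rw [← norm_arm j]; exact abs_real_inner_le_norm _ _

theorem simMap_sub_center (j : Fin 3) (x : Plane) :
    simMap j x - center = (1 / 3 : ℝ) • (x - center) + (2 / 3 : ℝ) • arm j := by
  rw [simMap, vertex_eq]
  module

/-- The inverse of the similarity `simMap j`. -/
def expand (j : Fin 3) (a : Plane) : Plane := (3 : ℝ) • a - (2 : ℝ) • vertex j

theorem simMap_expand (j : Fin 3) (a : Plane) : simMap j (expand j a) = a := by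
  rw [simMap, expand]; module

theorem expand_simMap (j : Fin 3) (a : Plane) : expand j (simMap j a) = a := by
  rw [simMap, expand]; module

theorem simMap_injective (j : Fin 3) : Function.Injective (simMap j) :=
  Function.LeftInverse.injective (expand_simMap j)

theorem expand_sub_center (j : Fin 3) (a : Plane) :
    expand j a - center = (3 : ℝ) • (a - center) - (2 : ℝ) • arm j := by
  rw [expand, vertex_eq]; module

theorem norm_simMap_sub (j : Fin 3) (x a : Plane) :
    ‖simMap j x - a‖ ^ 2 = 1 / 9 * ‖x - expand j a‖ ^ 2 := by
  have : simMap j x - a = (1 / 3 : ℝ) • (x - expand j a) := by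
    rw [simMap, expand]; module
  rw [this, norm_smul, mul_pow]; norm_num

theorem continuous_simMap (j : Fin 3) : Continuous (simMap j) := by
  unfold simMap; fun_prop

/-! ### The triangle and barycentric coordinates -/

/-- The `k`-th barycentric coordinate with respect to the vertices of `△`. -/
def bary (k : Fin 3) (x : Plane) : ℝ := 1 / 3 + 2 * inner ℝ (arm k) (x - center)

theorem bary_simMap (j k : Fin 3) (x : Plane) :
    bary k (simMap j x) = 1 / 3 * bary k x + if j = k then 2 / 3 else 0 := by
  rw [bary, simMap_sub_center, inner_add_right, inner_smul_right, inner_smul_right, inner_arm, bary]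
  by_cases h : j = k
  · simp [h]; ring
  · simp [h, Ne.symm h]; ring

theorem bary_vertex (j k : Fin 3) : bary k (vertex j) = if j = k then 1 else 0 := by
  rw [bary, ← arm, inner_arm]
  by_cases h : j = k
  · simp [h]; norm_num
  · simp [h, Ne.symm h]; norm_num

theorem sum_bary (x : Plane) : bary 0 x + bary 1 x + bary 2 x = 1 := by
  have := sum_inner_arm (x - center)
  simp only [bary]; linarith

theorem eq_sum_bary (x : Plane) :
    bary 0 x • vertex 0 + bary 1 x • vertex 1 + bary 2 x • vertex 2 = x := by
  have h3 : Real.sqrt 3 * Real.sqrt 3 = 3 := Real.mul_self_sqrt (by norm_num)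
  ext i
  fin_cases i
  · simp [bary, arm, vertex, center, PiLp.inner_apply, Fin.sum_univ_two]
    ring
  · simp [bary, arm, vertex, center, PiLp.inner_apply, Fin.sum_univ_two]
    ring_nf
    rw [show Real.sqrt 3 ^ 3 = Real.sqrt 3 * Real.sqrt 3 * Real.sqrt 3 by ring,
      show Real.sqrt 3 ^ 2 = Real.sqrt 3 * Real.sqrt 3 by ring, h3]
    ring

theorem mem_triangle_iff (x : Plane) : x ∈ triangle ↔ ∀ k, 0 ≤ bary k x := by
  constructor
  · intro hx k
    have hc : Convex ℝ {y : Plane | 0 ≤ bary k y} := by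
      intro y hy z hz s t hs ht hst
      simp only [mem_ofPred_eq] at hy hz ⊢
      have : bary k (s • y + t • z) = s * bary k y + t * bary k z := by
        have h1 : s • y + t • z - center = s • (y - center) + t • (z - center) := by
          have : center = (s + t) • center := by rw [hst, one_smul]
          nth_rewrite 1 [this]; module
        rw [bary, h1, inner_add_right, inner_smul_right, inner_smul_right, bary, bary]
        linear_combination (-1 / 3) * hst
      rw [this]; positivity
    refine convexHull_min ?_ hc hx
    rintro _ ⟨j, rfl⟩
    simp only [mem_ofPred_eq, bary_vertex]
    split_ifs <;> norm_num
  · intro h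
    have := (convex_convexHull ℝ (range vertex)).sum_mem (t := Finset.univ)
      (w := fun k => bary k x) (z := vertex) (fun k _ => h k)
      (by rw [Fin.sum_univ_three, sum_bary]) (fun k _ => subset_convexHull ℝ _ ⟨k, rfl⟩)
    rwa [Fin.sum_univ_three, eq_sum_bary] at this

theorem norm_sub_center_sq (x : Plane) :
    ‖x - center‖ ^ 2 =
      (bary 0 x ^ 2 + bary 1 x ^ 2 + bary 2 x ^ 2) / 2 - 1 / 6 := by
  have h1 := sum_inner_arm (x - center)
  have h2 := sum_inner_arm_sq (x - center)
  simp only [bary]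
  linear_combination (-2) * h2 - (2 / 3) * h1

theorem norm_sub_center_le {x : Plane} (hx : x ∈ triangle) : ‖x - center‖ ≤ circumradius := by
  rw [mem_triangle_iff] at hx
  refine abs_le_of_sq_le_sq' ?_ circumradius_pos.le |>.2
  rw [norm_sub_center_sq, circumradius_sq]
  have := sum_bary x
  nlinarith [hx 0, hx 1, hx 2, mul_nonneg (hx 0) (hx 1), mul_nonneg (hx 0) (hx 2),
    mul_nonneg (hx 1) (hx 2)]

theorem isClosed_triangle : IsClosed triangle := by
  have : triangle = ⋂ k, {x | 0 ≤ bary k x} := by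
    ext x; simp [mem_triangle_iff]
  rw [this]
  refine isClosed_iInter fun k => isClosed_le continuous_const ?_
  unfold bary; fun_prop

theorem isCompact_triangle : IsCompact triangle := by
  refine Metric.isCompact_of_isClosed_isBounded isClosed_triangle ?_
  refine (Metric.isBounded_closedBall (x := center) (r := circumradius)).subset fun x hx => ?_
  rw [Metric.mem_closedBall, dist_eq_norm]
  exact norm_sub_center_le hx

/-! ### Integration against the R-measure -/

theorem address_mem_triangle (σ : ℕ → Fin 3) : address σ ∈ triangle := by
  have hw : HasSum (fun k : ℕ => (2 / 3 : ℝ) * (1 / 3) ^ k) 1 := by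
    have := (hasSum_geometric_of_lt_one (r := (1 / 3 : ℝ)) (by norm_num) (by norm_num)).mul_left
      (2 / 3)
    norm_num at this ⊢
    exact this
  have hs : HasSum (fun k : ℕ => ((2 / 3 : ℝ) * (1 / 3) ^ k) • vertex (σ k)) (address σ) :=
    (Summable.of_norm_bounded summable_bound fun k => norm_term_le k (σ k)).hasSum
  rw [mem_triangle_iff]
  intro j
  -- `bary j` is affine, so it commutes with the infinite convex combination `address σ`.
  have h1 : HasSum (fun k : ℕ => ((2 / 3 : ℝ) * (1 / 3) ^ k) * bary j (vertex (σ k)))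
      (bary j (address σ)) := by
    have h2 := ((innerSL ℝ (arm j)).hasSum hs).mul_left 2
    have h3 := hw.mul_left (1 / 3 - 2 * inner ℝ (arm j) center)
    have h4 := h3.add h2
    have e1 : ∀ x, bary j x = 1 / 3 - 2 * inner ℝ (arm j) center + 2 * inner ℝ (arm j) x := by
      intro x; rw [bary, inner_sub_right]; ring
    simp only [innerSL_apply_apply, inner_smul_right, mul_one] at h4
    rw [e1]
    have e2 := funext fun k : ℕ => show
        (1 / 3 - 2 * inner ℝ (arm j) center) * (2 / 3 * (1 / 3) ^ k) +
          2 * (2 / 3 * (1 / 3) ^ k * inner ℝ (arm j) (vertex (σ k))) =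
        ((2 / 3 : ℝ) * (1 / 3) ^ k) * bary j (vertex (σ k)) by rw [e1]; ring
    rwa [e2] at h4
  refine h1.nonneg fun k => mul_nonneg (by positivity) ?_
  rw [bary_vertex]; split_ifs <;> norm_num

theorem ae_mem_triangle : ∀ᵐ x ∂rMeasure, x ∈ triangle := by
  exact (ae_map_iff measurable_address.aemeasurable isClosed_triangle.measurableSet).2
    (ae_of_all _ address_mem_triangle)

theorem integrable_of_continuous {E : Type*} [NormedAddCommGroup E] {f : Plane → E}
    [MeasurableSpace E] [BorelSpace E] [SecondCountableTopology E]
    (hf : Continuous f) : Integrable f rMeasure := by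
  obtain ⟨C, hC⟩ := isCompact_triangle.exists_bound_of_continuousOn hf.continuousOn
  refine Integrable.of_bound (C := C) hf.aestronglyMeasurable ?_
  filter_upwards [ae_mem_triangle] with x hx using hC x hx

theorem integral_eq_sum_simMap {E : Type*} [NormedAddCommGroup E] [NormedSpace ℝ E]
    [MeasurableSpace E] [BorelSpace E] [SecondCountableTopology E] {f : Plane → E}
    (hf : Continuous f) :
    ∫ x, f x ∂rMeasure = (1 / 3 : ℝ) • ∑ j, ∫ x, f (simMap j x) ∂rMeasure := by
  have hm : ∀ j, ∫ x, f x ∂(rMeasure.map (simMap j)) = ∫ x, f (simMap j x) ∂rMeasure := fun j =>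
    integral_map (measurable_simMap j).aemeasurable hf.aestronglyMeasurable
  conv_lhs => rw [rMeasure_selfSimilar]
  rw [integral_smul_measure, integral_finsetSum_measure]
  · simp only [hm]
    norm_num
  · intro j _
    rw [integrable_map_measure hf.aestronglyMeasurable (measurable_simMap j).aemeasurable]
    exact integrable_of_continuous (hf.comp (continuous_simMap j))

theorem integral_mono_of_continuous {f g : Plane → ℝ} (hf : Continuous f) (hg : Continuous g)
    (h : ∀ x ∈ triangle, f x ≤ g x) : ∫ x, f x ∂rMeasure ≤ ∫ x, g x ∂rMeasure := by
  refine integral_mono_ae (integrable_of_continuous hf) (integrable_of_continuous hg) ?_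
  filter_upwards [ae_mem_triangle] with x hx using h x hx

theorem integral_inner_sub_center (a : Plane) :
    ∫ x, inner ℝ (x - center) a ∂rMeasure = 0 := by
  have h := integral_eq_sum_simMap (f := fun x => inner ℝ (x - center) a) (by fun_prop)
  simp only [simMap_sub_center, inner_add_left, inner_smul_left] at h
  have hi : Integrable (fun x : Plane => inner ℝ (x - center) a) rMeasure :=
    integrable_of_continuous (by fun_prop)
  have h2 : ∀ j : Fin 3, ∫ x, ((starRingEnd ℝ) (1 / 3) * inner ℝ (x - center) a +
      (starRingEnd ℝ) (2 / 3) * inner ℝ (arm j) a) ∂rMeasure =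
      1 / 3 * ∫ x, inner ℝ (x - center) a ∂rMeasure + 2 / 3 * inner ℝ (arm j) a := by
    intro j
    rw [integral_add (hi.const_mul _) (integrable_const _), integral_const_mul]
    simp
  simp only [h2, Fin.sum_univ_three, smul_eq_mul] at h
  have := sum_inner_arm a
  linarith

theorem integral_inner_sub_center_sq (a : Plane) :
    ∫ x, inner ℝ (x - center) a ^ 2 ∂rMeasure = ‖a‖ ^ 2 / 12 := by
  have h := integral_eq_sum_simMap (f := fun x => inner ℝ (x - center) a ^ 2) (by fun_prop)
  have hi : Integrable (fun x : Plane => inner ℝ (x - center) a) rMeasure :=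
    integrable_of_continuous (by fun_prop)
  have hi2 : Integrable (fun x : Plane => inner ℝ (x - center) a ^ 2) rMeasure :=
    integrable_of_continuous (by fun_prop)
  have h2 : ∀ j : Fin 3, ∫ x, inner ℝ (simMap j x - center) a ^ 2 ∂rMeasure =
      1 / 9 * ∫ x, inner ℝ (x - center) a ^ 2 ∂rMeasure + 4 / 9 * inner ℝ (arm j) a ^ 2 := by
    intro j
    have : ∀ x, inner ℝ (simMap j x - center) a ^ 2 = 1 / 9 * inner ℝ (x - center) a ^ 2 +
        (4 / 9 * inner ℝ (arm j) a * inner ℝ (x - center) a + 4 / 9 * inner ℝ (arm j) a ^ 2) := by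
      intro x
      rw [simMap_sub_center, inner_add_left, inner_smul_left, inner_smul_left]
      simp only [conj_trivial]
      ring
    have hc : Integrable (fun _ : Plane => 4 / 9 * inner ℝ (arm j) a ^ 2) rMeasure :=
      integrable_const _
    have hl : Integrable (fun x : Plane => 4 / 9 * inner ℝ (arm j) a * inner ℝ (x - center) a +
        4 / 9 * inner ℝ (arm j) a ^ 2) rMeasure := integrable_of_continuous (by fun_prop)
    simp only [this]
    rw [integral_add (hi2.const_mul _) hl, integral_add (hi.const_mul _) hc, integral_const_mul,
      integral_const_mul, integral_inner_sub_center]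
    simp
  simp only [h2, Fin.sum_univ_three, smul_eq_mul] at h
  have := sum_inner_arm_sq a
  linarith

theorem integral_norm_sub_center_sq : ∫ x, ‖x - center‖ ^ 2 ∂rMeasure = 1 / 6 := by
  have h : ∀ x : Plane, ‖x - center‖ ^ 2 = 2 * (inner ℝ (x - center) (arm 0) ^ 2 +
      inner ℝ (x - center) (arm 1) ^ 2 + inner ℝ (x - center) (arm 2) ^ 2) := by
    intro x
    have := sum_inner_arm_sq (x - center)
    rw [real_inner_comm (x - center), real_inner_comm (x - center) (arm 1),
      real_inner_comm (x - center) (arm 2)] at this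
    linarith
  have hi : ∀ j, Integrable (fun x : Plane => inner ℝ (x - center) (arm j) ^ 2) rMeasure :=
    fun j => integrable_of_continuous (by fun_prop)
  simp only [h]
  have h01 : Integrable (fun x : Plane => inner ℝ (x - center) (arm 0) ^ 2 +
      inner ℝ (x - center) (arm 1) ^ 2) rMeasure := (hi 0).add (hi 1)
  rw [integral_const_mul, integral_add h01 (hi 2), integral_add (hi 0) (hi 1)]
  simp only [integral_inner_sub_center_sq, norm_arm_sq]
  norm_num

/-! ### The distribution of an affine function -/

theorem abs_inner_sub_center_le {x : Plane} (hx : x ∈ triangle) (b : Plane) :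
    |inner ℝ (x - center) b| ≤ circumradius * ‖b‖ :=
  (abs_real_inner_le_norm _ _).trans
    (mul_le_mul_of_nonneg_right (norm_sub_center_le hx) (norm_nonneg _))

theorem integral_add_inner (h : ℝ) (b : Plane) :
    ∫ x, (h + inner ℝ (x - center) b) ∂rMeasure = h := by
  rw [integral_add (integrable_const _) (integrable_of_continuous (by fun_prop)),
    integral_inner_sub_center]
  simp

theorem integral_add_inner_sq (h : ℝ) (b : Plane) :
    ∫ x, (h + inner ℝ (x - center) b) ^ 2 ∂rMeasure =
      h ^ 2 + (circumradius * ‖b‖) ^ 2 / 4 := by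
  have e : ∀ x : Plane, (h + inner ℝ (x - center) b) ^ 2 =
      h * (h + inner ℝ (x - center) ((2 : ℝ) • b)) + inner ℝ (x - center) b ^ 2 := by
    intro x; rw [inner_smul_right]; ring
  simp only [e]
  rw [integral_add (integrable_of_continuous (by fun_prop))
    (integrable_of_continuous (by fun_prop)), integral_const_mul, integral_add_inner,
    integral_inner_sub_center_sq, mul_pow, circumradius_sq]
  ring

theorem sq_integral_abs_le (h : ℝ) (b : Plane) :
    (∫ x, |h + inner ℝ (x - center) b| ∂rMeasure) ^ 2 ≤
      h ^ 2 + (circumradius * ‖b‖) ^ 2 / 4 := by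
  set p := ∫ x, |h + inner ℝ (x - center) b| ∂rMeasure with hp
  have hi : Integrable (fun x : Plane => |h + inner ℝ (x - center) b|) rMeasure :=
    integrable_of_continuous (by fun_prop)
  have hi2 : Integrable (fun x : Plane => (h + inner ℝ (x - center) b) ^ 2) rMeasure :=
    integrable_of_continuous (by fun_prop)
  have h0 : 0 ≤ ∫ x, (|h + inner ℝ (x - center) b| - p) ^ 2 ∂rMeasure :=
    integral_nonneg fun x => sq_nonneg _
  have e : ∀ x : Plane, (|h + inner ℝ (x - center) b| - p) ^ 2 =
      (h + inner ℝ (x - center) b) ^ 2 - (2 * p * |h + inner ℝ (x - center) b| - p ^ 2) := by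
    intro x; rw [← sq_abs (h + inner ℝ (x - center) b)]; ring
  have hc : Integrable (fun _ : Plane => p ^ 2) rMeasure := integrable_const _
  have hl : Integrable (fun x : Plane => 2 * p * |h + inner ℝ (x - center) b| - p ^ 2) rMeasure :=
    (hi.const_mul _).sub hc
  simp only [e] at h0
  rw [integral_sub hi2 hl, integral_sub (hi.const_mul _) hc, integral_const_mul, ← hp,
    integral_add_inner_sq] at h0
  simp at h0
  linarith

theorem integral_abs_eq {h : ℝ} {b : Plane} (hb : circumradius * ‖b‖ ≤ |h|) :
    ∫ x, |h + inner ℝ (x - center) b| ∂rMeasure = |h| := by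
  rcases le_total 0 h with h0 | h0
  · rw [abs_of_nonneg h0] at hb ⊢
    refine (integral_congr_ae ?_).trans (integral_add_inner h b)
    filter_upwards [ae_mem_triangle] with x hx
    have := abs_le.1 (abs_inner_sub_center_le hx b)
    exact abs_of_nonneg (by linarith)
  · rw [abs_of_nonpos h0] at hb ⊢
    refine (integral_congr_ae (g := fun x => -(h + inner ℝ (x - center) b)) ?_).trans
      (by rw [integral_neg, integral_add_inner])
    filter_upwards [ae_mem_triangle] with x hx
    have := abs_le.1 (abs_inner_sub_center_le hx b)
    exact abs_of_nonpos (by linarith)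

theorem integral_abs_le {h : ℝ} {b : Plane} (hb : |h| ≤ circumradius * ‖b‖) :
    ∫ x, |h + inner ℝ (x - center) b| ∂rMeasure ≤ circumradius * ‖b‖ := by
  set k := circumradius * ‖b‖ with hk
  rcases (mul_nonneg circumradius_pos.le (norm_nonneg b)).eq_or_lt with h0 | h0
  · rw [← hk] at h0
    rw [integral_abs_eq (by rw [← hk, ← h0]; positivity)]
    exact hb
  · rw [← hk] at h0
    -- For `|h|, |w| ≤ k` both `(k - h) (k - w)` and `(k + h) (k + w)` are nonnegative.
    have : ∫ x, |h + inner ℝ (x - center) b| ∂rMeasure ≤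
        ∫ x, (k + inner ℝ (x - center) ((h / k) • b)) ∂rMeasure := by
      refine integral_mono_of_continuous (by fun_prop) (by fun_prop) fun x hx => ?_
      have hw := abs_le.1 (abs_inner_sub_center_le hx b)
      have hh := abs_le.1 hb
      rw [← hk] at hw
      rw [inner_smul_right]
      generalize inner ℝ (x - center) b = w at hw ⊢
      have i₁ : 0 ≤ (k - h) * (k - w) / k :=
        div_nonneg (mul_nonneg (by linarith) (by linarith)) h0.le
      have i₂ : 0 ≤ (k + h) * (k + w) / k :=
        div_nonneg (mul_nonneg (by linarith) (by linarith)) h0.le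
      have e₁ : (k - h) * (k - w) / k = k - w - h + h / k * w := by field_simp; ring
      have e₂ : (k + h) * (k + w) / k = k + w + h + h / k * w := by field_simp; ring
      rw [abs_le]
      constructor <;> linarith
    rwa [integral_add_inner] at this

theorem integral_posPart_eq (h : ℝ) (b : Plane) :
    ∫ x, max 0 (h + inner ℝ (x - center) b) ∂rMeasure =
      (h + ∫ x, |h + inner ℝ (x - center) b| ∂rMeasure) / 2 := by
  have e : ∀ x : Plane, max 0 (h + inner ℝ (x - center) b) =
      ((h + inner ℝ (x - center) b) + |h + inner ℝ (x - center) b|) / 2 := by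
    intro x
    rcases le_total 0 (h + inner ℝ (x - center) b) with h0 | h0
    · rw [max_eq_right h0, abs_of_nonneg h0]; ring
    · rw [max_eq_left h0, abs_of_nonpos h0]; ring
  simp only [e]
  rw [integral_div, integral_add (integrable_of_continuous (by fun_prop))
    (integrable_of_continuous (by fun_prop)), integral_add_inner]

theorem integral_posPart_eq_zero {h : ℝ} {b : Plane} (hb : h ≤ -(circumradius * ‖b‖)) :
    ∫ x, max 0 (h + inner ℝ (x - center) b) ∂rMeasure = 0 := by
  have hk := mul_nonneg circumradius_pos.le (norm_nonneg b)
  have h0 : |h| = -h := abs_of_nonpos (by linarith)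
  rw [integral_posPart_eq, integral_abs_eq (by linarith), h0]
  ring

theorem integral_posPart_le {h : ℝ} {b : Plane} (hb : |h| ≤ circumradius * ‖b‖) :
    ∫ x, max 0 (h + inner ℝ (x - center) b) ∂rMeasure ≤ (circumradius * ‖b‖ + h) / 2 := by
  rw [integral_posPart_eq]
  linarith [integral_abs_le hb]

/-- For `-k ≤ h ≤ 0` and `|w| ≤ k`, the positive part of `h + w` lies below the parabola
`(k + h) (k + w)² / (4 k²)`. -/
theorem integral_posPart_le_of_nonpos {h : ℝ} {b : Plane} (hb : -(circumradius * ‖b‖) ≤ h)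
    (h0 : h ≤ 0) :
    ∫ x, max 0 (h + inner ℝ (x - center) b) ∂rMeasure ≤ 5 / 16 * (circumradius * ‖b‖ + h) := by
  set k := circumradius * ‖b‖ with hk
  rcases (mul_nonneg circumradius_pos.le (norm_nonneg b)).eq_or_lt with k0 | k0
  · rw [← hk] at k0
    rw [integral_posPart_eq_zero (by linarith)]
    linarith
  · rw [← hk] at k0
    have : ∫ x, max 0 (h + inner ℝ (x - center) b) ∂rMeasure ≤
        ∫ x, (k + h) / (4 * k ^ 2) * (k + inner ℝ (x - center) b) ^ 2 ∂rMeasure := by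
      refine integral_mono_of_continuous (by fun_prop) (by fun_prop) fun x hx => ?_
      have hw := abs_le.1 (abs_inner_sub_center_le hx b)
      rw [← hk] at hw
      generalize inner ℝ (x - center) b = w at hw ⊢
      refine max_le (mul_nonneg (div_nonneg (by linarith) (by positivity)) (sq_nonneg _)) ?_
      rw [div_mul_eq_mul_div, le_div_iff₀ (by positivity)]
      have i₁ : 0 ≤ (k - w) * (k - w) * (k + h) := mul_nonneg (mul_self_nonneg _) (by linarith)
      have i₂ : 0 ≤ (k - w) * k * (-h) :=
        mul_nonneg (mul_nonneg (by linarith) k0.le) (by linarith)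
      linarith
    rw [integral_const_mul, integral_add_inner_sq, ← hk] at this
    refine this.trans_eq ?_
    field_simp
    ring

/-! ### An inequality for three real numbers -/

/-- At most two of three numbers `q₁`, `q₂`, `q₃` with this spread are at most `1` in absolute
value, and if two are, then the third one dominates. -/
theorem sq_sum_lt_of_two_small {q₁ q₂ q₃ p₁ p₂ : ℝ}
    (hq : (q₁ - q₂) ^ 2 + (q₁ - q₃) ^ 2 + (q₂ - q₃) ^ 2 = 18)
    (hp₁ : p₁ ^ 2 ≤ q₁ ^ 2 + 1 / 4) (hp₂ : p₂ ^ 2 ≤ q₂ ^ 2 + 1 / 4)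
    (h₁ : |q₁| ≤ 1) (h₂ : |q₂| ≤ 1) (h1 : p₁ ≤ 1) (h2 : p₂ ≤ 1) :
    2 ≤ |q₃| ∧ (p₁ + p₂ + |q₃|) ^ 2 < 3 * (q₁ ^ 2 + q₂ ^ 2 + q₃ ^ 2) := by
  have hB : 2 ≤ |q₃| := by
    by_contra! h
    have e₁ : q₁ ^ 2 ≤ 1 := (sq_le_one_iff_abs_le_one _).2 h₁
    have e₂ : q₂ ^ 2 ≤ 1 := (sq_le_one_iff_abs_le_one _).2 h₂
    have e₃ : q₃ ^ 2 < 2 ^ 2 := sq_lt_sq.2 (by rwa [abs_two])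
    obtain ⟨a, b⟩ := abs_lt.1 h
    obtain ⟨c, d⟩ := abs_le.1 h₁
    obtain ⟨e, f⟩ := abs_le.1 h₂
    rcases le_total 0 (q₁ + q₂) with s | s
    · have i₁ : 0 ≤ (q₃ + 2) * (q₁ + q₂) := mul_nonneg (by linarith) s
      have i₂ : 0 ≤ (1 - q₁) * (1 - q₂) := mul_nonneg (by linarith) (by linarith)
      linarith
    · have i₁ : 0 ≤ (2 - q₃) * -(q₁ + q₂) := mul_nonneg (by linarith) (by linarith)
      have i₂ : 0 ≤ (1 + q₁) * (1 + q₂) := mul_nonneg (by linarith) (by linarith)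
      linarith
  refine ⟨hB, ?_⟩
  rw [← sq_abs q₃]
  have i₁ : 1 ≤ (|q₃| - p₁) ^ 2 := by
    rw [one_le_sq_iff₀ (by linarith)]; linarith
  have i₂ : 1 ≤ (|q₃| - p₂) ^ 2 := by
    rw [one_le_sq_iff₀ (by linarith)]; linarith
  linarith [sq_nonneg (p₁ - p₂)]

/-- One small number `q`, and two numbers `A`, `B` of equal sign. -/
theorem sq_sum_lt_of_same_side {A B q p : ℝ} (hAB : B ≤ A) (hB : 1 ≤ B) (hp : p ^ 2 ≤ q ^ 2 + 1 / 4)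
    (h1 : p ≤ 1) (hq : -1 ≤ q) (hq' : q ≤ 1)
    (h : (A - B) ^ 2 + (A - q) ^ 2 + (B - q) ^ 2 = 18) :
    (p + A + B) ^ 2 < 3 * (q ^ 2 + A ^ 2 + B ^ 2) := by
  have hA : 1.9 ≤ A := by
    by_contra! hh
    have i₁ : (A - B) ^ 2 ≤ 0.9 ^ 2 := pow_le_pow_left₀ (by linarith) (by linarith) 2
    have i₂ : (A - q) ^ 2 ≤ 2.9 ^ 2 := pow_le_pow_left₀ (by linarith) (by linarith) 2
    have i₃ : (B - q) ^ 2 ≤ 2.9 ^ 2 := pow_le_pow_left₀ (by linarith) (by linarith) 2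
    linarith
  have i₁ : 0.9 ^ 2 ≤ (A - p) ^ 2 := pow_le_pow_left₀ (by linarith) (by linarith) 2
  linarith [sq_nonneg (A + p - 2 * B)]

/-- One small number `q`, and two numbers `A`, `-B` of opposite signs. -/
theorem sq_sum_lt_of_opposite_sides {A B q p : ℝ} (hA : 1 ≤ A) (hB : 1 ≤ B)
    (hp : p ^ 2 ≤ q ^ 2 + 1 / 4) (h1 : p ≤ 1) (hq : -1 ≤ q) (hq' : q ≤ 1)
    (h : (A + B) ^ 2 + (A - q) ^ 2 + (B + q) ^ 2 = 18) :
    (p + A + B) ^ 2 < 3 * (q ^ 2 + A ^ 2 + B ^ 2) := by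
  by_cases hd : 1 / 2 < (A - B) ^ 2
  · linarith [sq_nonneg (A + B - 2 * p)]
  push Not at hd
  -- With `S = A + B` and `Δ = A - B` the hypothesis `h` reads `(3 / 4) S² = 9 - (Δ / 2 - q)²`.
  have hx : ((A - B) / 2 - q) ^ 2 ≤ (1 + |A - B| / 2) ^ 2 := by
    apply sq_le_sq.2
    rw [abs_of_nonneg (by positivity : 0 ≤ 1 + |A - B| / 2)]
    have := abs_sub ((A - B) / 2) q
    rw [abs_div, abs_two] at this
    have : |q| ≤ 1 := abs_le.2 ⟨hq, hq'⟩
    linarith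
  have hx0 : 0 ≤ |A - B| := abs_nonneg _
  have hxx : |A - B| ^ 2 = (A - B) ^ 2 := sq_abs _
  generalize |A - B| = x at hx hx0 hxx
  have hx1 : x ≤ 0.71 := abs_le_of_sq_le_sq' (by linarith) (by norm_num) |>.2
  have hS : 3.26 - 0.3 * x ≤ A + B := by
    refine abs_le_of_sq_le_sq' ?_ (by linarith) |>.2
    have : 0 ≤ x * (0.71 - x) := mul_nonneg hx0 (by linarith)
    linarith
  have i₁ : (1.26 - 0.3 * x) ^ 2 ≤ (A + B - 2 * p) ^ 2 :=
    pow_le_pow_left₀ (by linarith) (by linarith) 2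
  linarith [sq_nonneg (x - 0.122)]

theorem sq_sum_lt_of_one_small {q₁ q₂ q₃ p : ℝ}
    (hq : (q₁ - q₂) ^ 2 + (q₁ - q₃) ^ 2 + (q₂ - q₃) ^ 2 = 18)
    (hp : p ^ 2 ≤ q₁ ^ 2 + 1 / 4) (h₁ : |q₁| ≤ 1) (h1 : p ≤ 1) (h₂ : 1 ≤ |q₂|) (h₃ : 1 ≤ |q₃|) :
    (p + |q₂| + |q₃|) ^ 2 < 3 * (q₁ ^ 2 + q₂ ^ 2 + q₃ ^ 2) := by
  obtain ⟨c, d⟩ := abs_le.1 h₁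
  rw [← sq_abs q₂, ← sq_abs q₃]
  have key : ∀ A B q : ℝ, 1 ≤ A → 1 ≤ B → p ^ 2 ≤ q ^ 2 + 1 / 4 → -1 ≤ q → q ≤ 1 →
      (A - B) ^ 2 + (A - q) ^ 2 + (B - q) ^ 2 = 18 →
      (p + A + B) ^ 2 < 3 * (q ^ 2 + A ^ 2 + B ^ 2) := by
    intro A B q hA hB hp hq hq' h
    rcases le_total B A with hAB | hAB
    · exact sq_sum_lt_of_same_side hAB hB hp h1 hq hq' h
    · have := sq_sum_lt_of_same_side hAB hA hp h1 hq hq' (by linarith)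
      linarith
  rcases le_total 0 q₂ with s2 | s2 <;> rcases le_total 0 q₃ with s3 | s3
  · rw [abs_of_nonneg s2] at *; rw [abs_of_nonneg s3] at *
    exact key q₂ q₃ q₁ h₂ h₃ hp c d (by linarith)
  · rw [abs_of_nonneg s2] at *; rw [abs_of_nonpos s3] at *
    exact sq_sum_lt_of_opposite_sides h₂ h₃ hp h1 c d (by linarith)
  · rw [abs_of_nonpos s2] at *; rw [abs_of_nonneg s3] at *
    have := sq_sum_lt_of_opposite_sides h₃ h₂ hp h1 c d (by linarith)
    linarith
  · rw [abs_of_nonpos s2] at *; rw [abs_of_nonpos s3] at *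
    have := key (-q₂) (-q₃) (-q₁) h₂ h₃ (by linarith) (by linarith) (by linarith) (by linarith)
    linarith

/-- The sharp form of the Cauchy-Schwarz inequality `(∑ |qⱼ|)² ≤ 3 ∑ qⱼ²` that survives when `|qⱼ|`
is replaced by the larger number `pⱼ`. In the application `qⱼ` is the mean over the cell `j` of an
affine function whose deviation from its mean is at most `1` in absolute value and has variance
`1 / 4`, and `pⱼ` is the mean of the absolute value of this function; `pⱼ` differs from `|qⱼ|` only
if the function changes its sign on the cell, and then the spread of the `qⱼ` leaves enough room in
the Cauchy-Schwarz inequality. -/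
theorem sq_sum_lt_or_eq {q₁ q₂ q₃ p₁ p₂ p₃ : ℝ}
    (hq : (q₁ - q₂) ^ 2 + (q₁ - q₃) ^ 2 + (q₂ - q₃) ^ 2 = 18)
    (h₁ : p₁ ^ 2 ≤ q₁ ^ 2 + 1 / 4) (h₂ : p₂ ^ 2 ≤ q₂ ^ 2 + 1 / 4) (h₃ : p₃ ^ 2 ≤ q₃ ^ 2 + 1 / 4)
    (f₁ : 1 ≤ |q₁| → p₁ = |q₁|) (f₂ : 1 ≤ |q₂| → p₂ = |q₂|) (f₃ : 1 ≤ |q₃| → p₃ = |q₃|)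
    (n₁ : |q₁| ≤ 1 → p₁ ≤ 1) (n₂ : |q₂| ≤ 1 → p₂ ≤ 1) (n₃ : |q₃| ≤ 1 → p₃ ≤ 1) :
    (p₁ + p₂ + p₃) ^ 2 < 3 * (q₁ ^ 2 + q₂ ^ 2 + q₃ ^ 2) ∨
      ((p₁ + p₂ + p₃) ^ 2 = 3 * (q₁ ^ 2 + q₂ ^ 2 + q₃ ^ 2) ∧ |q₁| = |q₂| ∧ |q₂| = |q₃|) := by
  rcases lt_or_ge |q₁| 1 with l₁ | l₁ <;> rcases lt_or_ge |q₂| 1 with l₂ | l₂ <;>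
    rcases lt_or_ge |q₃| 1 with l₃ | l₃
  · exact absurd (sq_sum_lt_of_two_small hq h₁ h₂ l₁.le l₂.le (n₁ l₁.le) (n₂ l₂.le)).1 (by linarith)
  · left; rw [f₃ l₃]
    exact (sq_sum_lt_of_two_small hq h₁ h₂ l₁.le l₂.le (n₁ l₁.le) (n₂ l₂.le)).2
  · left; rw [f₂ l₂]
    have := (sq_sum_lt_of_two_small (q₃ := q₂) (by linarith) h₁ h₃ l₁.le l₃.le
      (n₁ l₁.le) (n₃ l₃.le)).2
    linarith
  · left; rw [f₂ l₂, f₃ l₃]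
    exact sq_sum_lt_of_one_small hq h₁ l₁.le (n₁ l₁.le) l₂ l₃
  · left; rw [f₁ l₁]
    have := (sq_sum_lt_of_two_small (q₃ := q₁) (by linarith) h₂ h₃ l₂.le l₃.le
      (n₂ l₂.le) (n₃ l₃.le)).2
    linarith
  · left; rw [f₁ l₁, f₃ l₃]
    have := sq_sum_lt_of_one_small (by linarith) h₂ l₂.le (n₂ l₂.le) l₁ l₃
    linarith
  · left; rw [f₁ l₁, f₂ l₂]
    have := sq_sum_lt_of_one_small (by linarith) h₃ l₃.le (n₃ l₃.le) l₁ l₂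
    linarith
  · rw [f₁ l₁, f₂ l₂, f₃ l₃]
    rw [← sq_abs q₁, ← sq_abs q₂, ← sq_abs q₃]
    by_cases h : |q₁| = |q₂| ∧ |q₂| = |q₃|
    · right
      refine ⟨?_, h⟩
      rw [h.1, h.2]; ring
    · left
      by_contra! hh
      apply h
      have e : (|q₁| - |q₂|) ^ 2 + (|q₁| - |q₃|) ^ 2 + (|q₂| - |q₃|) ^ 2 ≤ 0 := by linarith
      constructor
      · have : (|q₁| - |q₂|) ^ 2 = 0 := by
          linarith [sq_nonneg (|q₁| - |q₂|), sq_nonneg (|q₁| - |q₃|), sq_nonneg (|q₂| - |q₃|)]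
        linarith [pow_eq_zero_iff (two_ne_zero) |>.1 this]
      · have : (|q₂| - |q₃|) ^ 2 = 0 := by
          linarith [sq_nonneg (|q₁| - |q₂|), sq_nonneg (|q₁| - |q₃|), sq_nonneg (|q₂| - |q₃|)]
        linarith [pow_eq_zero_iff (two_ne_zero) |>.1 this]

/-! ### The gain of a point -/

/-- The function `u(x) - ‖x - a‖²` with the dual potential `u(x) = 2 / 27 + ‖x - c‖²`, where `c`
is the centroid of `△`. It is an affine function of `x`. -/
def excess (a x : Plane) : ℝ := 2 / 27 + ‖x - center‖ ^ 2 - ‖x - a‖ ^ 2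

theorem excess_eq (a x : Plane) :
    excess a x = 2 / 27 - ‖a - center‖ ^ 2 + 2 * inner ℝ (x - center) (a - center) := by
  have : x - a = (x - center) - (a - center) := by abel
  rw [excess, this, norm_sub_sq_real (x - center)]
  ring

theorem continuous_excess (a : Plane) : Continuous (excess a) := by
  unfold excess; fun_prop

/-- The gain of the point `a` at level `ℓ`. At level `0` it is the integral of the positive part of
`excess a`; at level `ℓ + 1` it is the sum of the gains at level `ℓ` of the three preimages of `a`
under the similarities, rescaled by the factor `1 / 27` by which the first level cells contribute
to the distortion error. -/
def gain : ℕ → Plane → ℝ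
  | 0, a => ∫ x, max 0 (excess a x) ∂rMeasure
  | ℓ + 1, a => 1 / 27 * ∑ j, gain ℓ (expand j a)

/-- The mean of `excess a` over the cell of the letter `j`. -/
def cellMean (a : Plane) (j : Fin 3) : ℝ :=
  2 / 27 - ‖a - center‖ ^ 2 + 4 / 3 * inner ℝ (arm j) (a - center)

theorem excess_simMap (a x : Plane) (j : Fin 3) :
    excess a (simMap j x) =
      cellMean a j + inner ℝ (x - center) ((2 / 3 : ℝ) • (a - center)) := by
  rw [excess_eq, simMap_sub_center, inner_add_left, inner_smul_left, inner_smul_left, cellMean,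
    inner_smul_right]
  simp only [conj_trivial]
  ring

theorem gain_zero_eq (a : Plane) :
    gain 0 a = 1 / 3 * ∑ j, ∫ x, max 0 (cellMean a j +
      inner ℝ (x - center) ((2 / 3 : ℝ) • (a - center))) ∂rMeasure := by
  rw [gain, integral_eq_sum_simMap (continuous_const.max (continuous_excess a))]
  simp only [excess_simMap, smul_eq_mul]

theorem sum_cellMean (a : Plane) :
    cellMean a 0 + cellMean a 1 + cellMean a 2 = 3 * (2 / 27 - ‖a - center‖ ^ 2) := by
  have := sum_inner_arm (a - center)
  simp only [cellMean]; linarith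

theorem sum_cellMean_sq (a : Plane) :
    cellMean a 0 ^ 2 + cellMean a 1 ^ 2 + cellMean a 2 ^ 2 =
      3 * (2 / 27 + ‖a - center‖ ^ 2) ^ 2 := by
  have h1 := sum_inner_arm (a - center)
  have h2 := sum_inner_arm_sq (a - center)
  simp only [cellMean]
  linear_combination (8 / 3 * (2 / 27 - ‖a - center‖ ^ 2)) * h1 + 16 / 9 * h2

/-- The seven points `c`, `c + (2 / 3) eₖ`, `c - (1 / 3) eₖ`, where `c` is the centroid of `△` and
`eₖ` points from `c` to the `k`-th vertex: these are the centroids of the nonempty unions of first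
level cells. -/
def IsCellMean (a : Plane) : Prop :=
  ∃ (k : Fin 3) (t : ℝ), (t = 0 ∨ t = 2 / 3 ∨ t = -1 / 3) ∧ a = center + t • arm k

/-- If `a ≠ c` and the three means of `excess a` over the first level cells agree in absolute
value, then `a` is the centroid of one or two first level cells. -/
theorem isCellMean_of_abs_eq {a : Plane} (ha : a ≠ center)
    (h₁ : |cellMean a 0| = |cellMean a 1|) (h₂ : |cellMean a 1| = |cellMean a 2|) :
    IsCellMean a := by
  have hr : 0 < ‖a - center‖ ^ 2 := by
    have := norm_pos_iff.2 (sub_ne_zero.2 ha); positivity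
  have hs := sum_inner_arm (a - center)
  have hs2 := sum_inner_arm_sq (a - center)
  -- If the inner products of `a - c` with the arms `i` and `j` agree, then `a - c` is a multiple of
  -- the arm `k`, and the scalar is a root of a quadratic equation.
  have key : ∀ i j k : Fin 3, (∀ x : Plane, inner ℝ (arm i) x + inner ℝ (arm j) x +
      inner ℝ (arm k) x = 0) → inner ℝ (arm i) (a - center) = inner ℝ (arm j) (a - center) →
      cellMean a i = -cellMean a k → inner ℝ (arm i) (a - center) ^ 2 +
      inner ℝ (arm j) (a - center) ^ 2 + inner ℝ (arm k) (a - center) ^ 2 =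
        ‖a - center‖ ^ 2 / 2 → IsCellMean a := by
    intro i j k hs he hk hs2
    have hs' := hs (a - center)
    set y := inner ℝ (arm k) (a - center) with hy
    have hi : inner ℝ (arm i) (a - center) = -y / 2 := by linarith
    have hj : inner ℝ (arm j) (a - center) = -y / 2 := by linarith
    have hn : ‖a - center‖ ^ 2 = 3 * y ^ 2 := by rw [hi, hj] at hs2; linarith
    have hv : a - center = (3 * y) • arm k := by
      have : ‖a - center - (3 * y) • arm k‖ ^ 2 = 0 := by
        rw [norm_sub_sq_real, inner_smul_right, norm_smul, mul_pow, norm_arm_sq, hn,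
          real_inner_comm, ← hy, Real.norm_eq_abs, sq_abs]
        ring
      exact sub_eq_zero.1 (norm_eq_zero.1 (pow_eq_zero_iff two_ne_zero |>.1 this))
    have hq : (3 * y - 2 / 3) * (3 * y + 1 / 3) = 0 := by
      rw [cellMean, cellMean, ← hy, hi, hn] at hk
      linarith
    refine ⟨k, 3 * y, ?_, by rw [← hv]; abel⟩
    rcases mul_eq_zero.1 hq with h | h
    · right; left; linarith
    · right; right; linarith
  have c0 : cellMean a 0 = 2 / 27 - ‖a - center‖ ^ 2 + 4 / 3 * inner ℝ (arm 0) (a - center) := rfl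
  have c1 : cellMean a 1 = 2 / 27 - ‖a - center‖ ^ 2 + 4 / 3 * inner ℝ (arm 1) (a - center) := rfl
  have c2 : cellMean a 2 = 2 / 27 - ‖a - center‖ ^ 2 + 4 / 3 * inner ℝ (arm 2) (a - center) := rfl
  rcases abs_eq_abs.1 h₁ with e₁ | e₁ <;> rcases abs_eq_abs.1 h₂ with e₂ | e₂
  · exfalso
    have x0 : inner ℝ (arm 0) (a - center) = 0 := by linarith
    have x1 : inner ℝ (arm 1) (a - center) = 0 := by linarith
    have x2 : inner ℝ (arm 2) (a - center) = 0 := by linarith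
    rw [x0, x1, x2] at hs2
    linarith
  · exact key 0 1 2 sum_inner_arm (by linarith) (by linarith) hs2
  · exact key 1 2 0 (fun x => by linarith [sum_inner_arm x]) (by linarith) (by linarith)
      (by linarith)
  · exact key 2 0 1 (fun x => by linarith [sum_inner_arm x]) (by linarith) (by linarith)
      (by linarith)

/-- The gain at level `0` is at most `2 / 27`, with equality only at the seven centroids of unions
of first level cells. -/
theorem gain_zero_lt_or (a : Plane) :
    gain 0 a < 2 / 27 ∨ (gain 0 a = 2 / 27 ∧ IsCellMean a) := by
  by_cases ha : a = center
  · right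
    refine ⟨?_, 0, 0, Or.inl rfl, by rw [ha, zero_smul, add_zero]⟩
    rw [gain]
    have : ∀ x, excess a x = 2 / 27 := by
      intro x; rw [excess_eq, ha]; simp
    simp only [this]
    norm_num
  have hr : 0 < ‖a - center‖ := norm_pos_iff.2 (sub_ne_zero.2 ha)
  set b := (2 / 3 : ℝ) • (a - center) with hb
  set k := circumradius * ‖b‖ with hk
  have hk0 : 0 < k := by
    rw [hk, hb, norm_smul]
    have := circumradius_pos
    have h23 : (0 : ℝ) < ‖(2 / 3 : ℝ)‖ := by norm_num
    positivity
  have hk2 : k ^ 2 = 4 / 27 * ‖a - center‖ ^ 2 := by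
    rw [hk, hb, norm_smul, mul_pow, mul_pow, circumradius_sq]; norm_num; ring
  set p : Fin 3 → ℝ := fun j => ∫ x, |cellMean a j + inner ℝ (x - center) b| ∂rMeasure with hp
  have hg : gain 0 a = 1 / 6 * (3 * (2 / 27 - ‖a - center‖ ^ 2) + (p 0 + p 1 + p 2)) := by
    rw [gain_zero_eq, ← sum_cellMean]
    simp only [integral_posPart_eq, Fin.sum_univ_three, ← hb, hp]
    ring
  have H1 : ∀ j, (p j / k) ^ 2 ≤ (cellMean a j / k) ^ 2 + 1 / 4 := by
    intro j
    have := sq_integral_abs_le (cellMean a j) b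
    rw [← hk] at this
    rw [div_pow, div_pow, div_le_iff₀ (by positivity), add_mul, div_mul_cancel₀ _ (by positivity)]
    linarith
  have H2 : ∀ j, 1 ≤ |cellMean a j / k| → p j / k = |cellMean a j / k| := by
    intro j hj
    rw [abs_div, abs_of_pos hk0] at hj ⊢
    rw [le_div_iff₀ hk0, one_mul] at hj
    rw [hp]; simp only; rw [integral_abs_eq hj]
  have H3 : ∀ j, |cellMean a j / k| ≤ 1 → p j / k ≤ 1 := by
    intro j hj
    rw [abs_div, abs_of_pos hk0, div_le_one hk0] at hj
    rw [div_le_one hk0]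
    exact integral_abs_le hj
  have hs := sum_cellMean a
  have hs2 := sum_cellMean_sq a
  have H0 : (cellMean a 0 / k - cellMean a 1 / k) ^ 2 + (cellMean a 0 / k - cellMean a 2 / k) ^ 2 +
      (cellMean a 1 / k - cellMean a 2 / k) ^ 2 = 18 := by
    have : (cellMean a 0 - cellMean a 1) ^ 2 + (cellMean a 0 - cellMean a 2) ^ 2 +
      (cellMean a 1 - cellMean a 2) ^ 2 = 18 * k ^ 2 := by
      rw [hk2]
      linear_combination 3 * hs2 - (cellMean a 0 + cellMean a 1 + cellMean a 2 +
        3 * (2 / 27 - ‖a - center‖ ^ 2)) * hs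
    rw [← sub_div, ← sub_div, ← sub_div, div_pow, div_pow, div_pow, ← add_div, ← add_div, this]
    field_simp
  have e₁ : (p 0 / k + p 1 / k + p 2 / k) ^ 2 = (p 0 + p 1 + p 2) ^ 2 / k ^ 2 := by
    rw [← add_div, ← add_div, div_pow]
  have e₂ : 3 * ((cellMean a 0 / k) ^ 2 + (cellMean a 1 / k) ^ 2 + (cellMean a 2 / k) ^ 2) =
      (3 * (2 / 27 + ‖a - center‖ ^ 2)) ^ 2 / k ^ 2 := by
    rw [div_pow, div_pow, div_pow, ← add_div, ← add_div, hs2]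
    ring
  rcases sq_sum_lt_or_eq H0 (H1 0) (H1 1) (H1 2) (H2 0) (H2 1) (H2 2) (H3 0) (H3 1) (H3 2) with
    h | ⟨h, h₁, h₂⟩
  · left
    rw [e₁, e₂, div_lt_div_iff_of_pos_right (by positivity)] at h
    have := abs_lt_of_sq_lt_sq' h (by positivity) |>.2
    rw [hg]; linarith
  · right
    rw [e₁, e₂, div_left_inj' (by positivity)] at h
    have hp0 : ∀ j, 0 ≤ p j := fun j => integral_nonneg fun x => abs_nonneg _
    have := (pow_left_inj₀ (by linarith [hp0 0, hp0 1, hp0 2]) (by positivity) two_ne_zero).1 h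
    refine ⟨by rw [hg]; linarith, isCellMean_of_abs_eq ha ?_ ?_⟩
    · rw [abs_div, abs_div, abs_of_pos hk0, div_left_inj' hk0.ne'] at h₁
      exact h₁
    · rw [abs_div, abs_div, abs_of_pos hk0, div_left_inj' hk0.ne'] at h₂
      exact h₂

theorem gain_zero_le (a : Plane) : gain 0 a ≤ 2 / 27 := by
  rcases gain_zero_lt_or a with h | h
  · exact h.le
  · exact h.1.le

/-! ### Gains of distant points -/

theorem circumradius_bounds : 0.577 < circumradius ∧ circumradius < 0.5774 := by
  have h := circumradius_sq
  have h0 := circumradius_pos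
  constructor
  · exact abs_lt_of_sq_lt_sq' (by rw [h]; norm_num) h0.le |>.2
  · exact abs_lt_of_sq_lt_sq' (by rw [h]; norm_num) (by norm_num) |>.2

/-- An upper bound for `excess a` on the circumscribed disc of `△`, as a function of the distance
`r` of `a` from the centroid. -/
def excessBound (r : ℝ) : ℝ := 2 / 27 - r ^ 2 + 2 * circumradius * r

theorem excessBound_le {r s : ℝ} (hr : 0.58 ≤ r) (hs : r ≤ s) : excessBound s ≤ excessBound r := by
  have := circumradius_bounds
  have : 0 ≤ (s - r) * (s + r - 2 * circumradius) := mul_nonneg (by linarith) (by linarith)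
  unfold excessBound
  linarith

theorem lt_of_excessBound_pos {r : ℝ} (h : 0 < excessBound r) : r < 1.22 := by
  by_contra! hr
  have := excessBound_le (by norm_num) hr
  have := circumradius_bounds
  unfold excessBound at *
  linarith

theorem cellMean_bounds (a : Plane) (j : Fin 3) :
    2 / 27 - ‖a - center‖ ^ 2 - 4 / 3 * (circumradius * ‖a - center‖) ≤ cellMean a j ∧
      cellMean a j ≤ 2 / 27 - ‖a - center‖ ^ 2 + 4 / 3 * (circumradius * ‖a - center‖) := by
  have := abs_le.1 (abs_inner_arm_le j (a - center))
  unfold cellMean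
  constructor <;> linarith

theorem circumradius_mul_norm (a : Plane) :
    circumradius * ‖(2 / 3 : ℝ) • (a - center)‖ = 2 / 3 * (circumradius * ‖a - center‖) := by
  rw [norm_smul]; norm_num; ring

theorem gain_zero_eq_zero {a : Plane} (h : excessBound ‖a - center‖ ≤ 0) : gain 0 a = 0 := by
  rw [gain_zero_eq, Finset.sum_eq_zero, mul_zero]
  intro j _
  refine integral_posPart_eq_zero ?_
  rw [circumradius_mul_norm]
  have := (cellMean_bounds a j).2
  unfold excessBound at h
  linarith

/-- Let `h j` be the mean of `excess a` over the cell `j` and let `k` bound the deviation from this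
mean. If every cell contributes at most `κ (k + h j)`, then, for `a` far from the centroid, the
contributions add up to at most `κ` times `excessBound`, no matter how many cells contribute. -/
theorem gain_zero_le_of_cell_bounds {a : Plane} {κ : ℝ} (hκ : 0 ≤ κ)
    (hr : 2 / 27 - ‖a - center‖ ^ 2 + 2 / 3 * (circumradius * ‖a - center‖) ≤ 0)
    (hH : 0 ≤ excessBound ‖a - center‖)
    (h : ∀ j, -(2 / 3 * (circumradius * ‖a - center‖)) ≤ cellMean a j →
      ∫ x, max 0 (cellMean a j + inner ℝ (x - center) ((2 / 3 : ℝ) • (a - center))) ∂rMeasure ≤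
        κ * (2 / 3 * (circumradius * ‖a - center‖) + cellMean a j)) :
    gain 0 a ≤ 1 / 3 * (κ * excessBound ‖a - center‖) := by
  rw [gain_zero_eq, Fin.sum_univ_three]
  refine mul_le_mul_of_nonneg_left ?_ (by norm_num)
  have hs := sum_cellMean a
  have b0 := cellMean_bounds a 0
  have b1 := cellMean_bounds a 1
  have b2 := cellMean_bounds a 2
  have hz : ∀ j, cellMean a j ≤ -(2 / 3 * (circumradius * ‖a - center‖)) →
      ∫ x, max 0 (cellMean a j + inner ℝ (x - center) ((2 / 3 : ℝ) • (a - center))) ∂rMeasure =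
        0 := by
    intro j hj
    refine integral_posPart_eq_zero ?_
    rwa [circumradius_mul_norm]
  unfold excessBound at *
  set m := 2 / 27 - ‖a - center‖ ^ 2
  set k := circumradius * ‖a - center‖
  have hfin : ∀ t : ℝ, t ≤ m + 2 * k → κ * t ≤ κ * (m + 2 * circumradius * ‖a - center‖) := by
    intro t ht
    refine mul_le_mul_of_nonneg_left (ht.trans_eq ?_) hκ
    ring
  rcases le_total (cellMean a 0) (-(2 / 3 * k)) with h0 | h0 <;>
    rcases le_total (cellMean a 1) (-(2 / 3 * k)) with h1 | h1 <;>
    rcases le_total (cellMean a 2) (-(2 / 3 * k)) with h2 | h2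
  · rw [hz 0 h0, hz 1 h1, hz 2 h2, add_zero, add_zero]
    exact mul_nonneg hκ hH
  · rw [hz 0 h0, hz 1 h1]
    linarith [h 2 h2, hfin (2 / 3 * k + cellMean a 2) (by linarith)]
  · rw [hz 0 h0, hz 2 h2]
    linarith [h 1 h1, hfin (2 / 3 * k + cellMean a 1) (by linarith)]
  · rw [hz 0 h0]
    linarith [h 1 h1, h 2 h2, hfin (4 / 3 * k + cellMean a 1 + cellMean a 2) (by linarith)]
  · rw [hz 1 h1, hz 2 h2]
    linarith [h 0 h0, hfin (2 / 3 * k + cellMean a 0) (by linarith)]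
  · rw [hz 1 h1]
    linarith [h 0 h0, h 2 h2, hfin (4 / 3 * k + cellMean a 0 + cellMean a 2) (by linarith)]
  · rw [hz 2 h2]
    linarith [h 0 h0, h 1 h1, hfin (4 / 3 * k + cellMean a 0 + cellMean a 1) (by linarith)]
  · have h3 : 2 * k + cellMean a 0 + cellMean a 1 + cellMean a 2 ≤ m + 2 * k := by
      have : m + 2 * circumradius * ‖a - center‖ = m + 2 * k := by ring
      linarith
    linarith [h 0 h0, h 1 h1, h 2 h2, hfin _ h3]

theorem gain_zero_le_of_far {a : Plane} (hr : 0.7 ≤ ‖a - center‖)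
    (hH : 0 ≤ excessBound ‖a - center‖) : gain 0 a ≤ 1 / 6 * excessBound ‖a - center‖ := by
  have hc := circumradius_bounds
  have hm : 2 / 27 - ‖a - center‖ ^ 2 + 2 / 3 * (circumradius * ‖a - center‖) ≤ 0 := by
    have i₁ : 0 ≤ (0.5774 - circumradius) * ‖a - center‖ :=
      mul_nonneg (by linarith) (norm_nonneg _)
    have i₂ : 0 ≤ (‖a - center‖ - 0.7) * ‖a - center‖ :=
      mul_nonneg (by linarith) (norm_nonneg _)
    linarith
  have := gain_zero_le_of_cell_bounds (κ := 1 / 2) (by norm_num) hm hH fun j hj => by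
    have := integral_posPart_le (h := cellMean a j) (b := (2 / 3 : ℝ) • (a - center)) (by
      rw [circumradius_mul_norm, abs_le]
      exact ⟨hj, by linarith [(cellMean_bounds a j).2]⟩)
    rw [circumradius_mul_norm] at this
    linarith
  linarith

theorem gain_zero_le_of_one_le {a : Plane} (hr : 1 ≤ ‖a - center‖)
    (hH : 0 ≤ excessBound ‖a - center‖) : gain 0 a ≤ 5 / 48 * excessBound ‖a - center‖ := by
  have hc := circumradius_bounds
  have hm : 2 / 27 - ‖a - center‖ ^ 2 + 4 / 3 * (circumradius * ‖a - center‖) ≤ 0 := by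
    have i₁ : 0 ≤ (0.5774 - circumradius) * ‖a - center‖ :=
      mul_nonneg (by linarith) (norm_nonneg _)
    have i₂ : 0 ≤ (‖a - center‖ - 1) * ‖a - center‖ :=
      mul_nonneg (by linarith) (norm_nonneg _)
    linarith
  have hk : 0 ≤ circumradius * ‖a - center‖ := mul_nonneg circumradius_pos.le (norm_nonneg _)
  have := gain_zero_le_of_cell_bounds (κ := 5 / 16) (by norm_num) (by linarith) hH fun j hj => by
    have := integral_posPart_le_of_nonpos (h := cellMean a j)
      (b := (2 / 3 : ℝ) • (a - center)) (by rwa [circumradius_mul_norm])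
      (by linarith [(cellMean_bounds a j).2])
    rwa [circumradius_mul_norm] at this
  linarith

theorem excessBound_pos_of_gain_ne_zero {a : Plane} (h : gain 0 a ≠ 0) :
    0 < excessBound ‖a - center‖ := by
  by_contra! h'
  exact h (gain_zero_eq_zero h')

/-- Two points of positive gain whose distances from the centroid add up to at least `2`: the
farther one is at distance at least `1`, where the sharper bound for the gain applies. -/
theorem gain_zero_add_lt_of_le {a b : Plane} (ha : gain 0 a ≠ 0) (hb : gain 0 b ≠ 0)
    (hab : 2 ≤ ‖a - center‖ + ‖b - center‖) (hle : ‖a - center‖ ≤ ‖b - center‖) :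
    gain 0 a + gain 0 b < 2 / 27 := by
  have hc := circumradius_bounds
  have Ha := excessBound_pos_of_gain_ne_zero ha
  have Hb := excessBound_pos_of_gain_ne_zero hb
  have la := lt_of_excessBound_pos Ha
  have lb := lt_of_excessBound_pos Hb
  have ga := gain_zero_le_of_far (by linarith) Ha.le
  have gb := gain_zero_le_of_one_le (by linarith) Hb.le
  rcases le_total 1 ‖a - center‖ with h1 | h1
  · have e₁ := excessBound_le (by norm_num) h1
    have e₂ := excessBound_le (by norm_num) (h1.trans hle)
    have e₃ : excessBound 1 < 0.23 := by unfold excessBound; linarith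
    linarith
  · have e₂ := excessBound_le (r := 2 - ‖a - center‖) (s := ‖b - center‖) (by linarith)
      (by linarith)
    set x := ‖a - center‖
    have i₁ : 0 ≤ (0.5774 - circumradius) * x := mul_nonneg (by linarith) (by linarith)
    have i₂ : 0 ≤ (0.5774 - circumradius) * (2 - x) := mul_nonneg (by linarith) (by linarith)
    have : 1 / 6 * excessBound x + 5 / 48 * excessBound (2 - x) < 2 / 27 := by
      unfold excessBound
      linarith [sq_nonneg (x - 0.88)]
    linarith

theorem gain_zero_add_lt {a b : Plane} (ha : gain 0 a ≠ 0) (hb : gain 0 b ≠ 0)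
    (hab : 2 ≤ ‖a - center‖ + ‖b - center‖) : gain 0 a + gain 0 b < 2 / 27 := by
  rcases le_total ‖a - center‖ ‖b - center‖ with h | h
  · exact gain_zero_add_lt_of_le ha hb hab h
  · rw [add_comm]; exact gain_zero_add_lt_of_le hb ha (by linarith) h

/-! ### Gains at all levels -/

theorem two_le_norm_expand_add (a : Plane) {i j : Fin 3} (hij : i ≠ j) :
    2 ≤ ‖expand i a - center‖ + ‖expand j a - center‖ := by
  have h : ‖arm i - arm j‖ ^ 2 = 1 := by
    rw [norm_sub_sq_real, norm_arm_sq, norm_arm_sq, inner_arm, if_neg hij]; norm_num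
  have h1 : ‖arm i - arm j‖ = 1 := by
    rwa [pow_eq_one_iff_of_nonneg (norm_nonneg _) two_ne_zero] at h
  have e : (2 : ℝ) • (arm i - arm j) = (expand j a - center) - (expand i a - center) := by
    rw [expand_sub_center, expand_sub_center]; module
  have h2 := norm_sub_le (expand j a - center) (expand i a - center)
  rw [← e, norm_smul, h1] at h2
  norm_num at h2
  linarith

theorem four_le_sum_norm_expand_sq (a : Plane) :
    4 ≤ ‖expand 0 a - center‖ ^ 2 + ‖expand 1 a - center‖ ^ 2 + ‖expand 2 a - center‖ ^ 2 := by
  have h : ∀ j, ‖expand j a - center‖ ^ 2 =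
      9 * ‖a - center‖ ^ 2 - 12 * inner ℝ (arm j) (a - center) + 4 / 3 := by
    intro j
    rw [expand_sub_center, norm_sub_sq_real, norm_smul, norm_smul, inner_smul_left,
      inner_smul_right, mul_pow, mul_pow, norm_arm_sq, real_inner_comm]
    norm_num
    ring
  rw [h, h, h]
  have := sum_inner_arm (a - center)
  linarith [sq_nonneg ‖a - center‖]

/-- If two of the three preimages of a point have positive gain at level `0`, then the sum of
their gains is below the maximal gain. -/
theorem sum_gain_zero_expand (a : Plane) :
    ∑ j, gain 0 (expand j a) < 2 / 27 ∨
      ∃ j, gain 0 (expand j a) = 2 / 27 ∧ ∀ i, i ≠ j → gain 0 (expand i a) = 0 := by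
  rw [Fin.sum_univ_three]
  have n0 := gain_zero_lt_or (expand 0 a)
  have n1 := gain_zero_lt_or (expand 1 a)
  have n2 := gain_zero_lt_or (expand 2 a)
  by_cases h0 : gain 0 (expand 0 a) = 0 <;> by_cases h1 : gain 0 (expand 1 a) = 0 <;>
    by_cases h2 : gain 0 (expand 2 a) = 0
  · left; rw [h0, h1, h2]; norm_num
  · rw [h0, h1, zero_add, zero_add]
    exact n2.imp_right fun h => ⟨2, h.1, by intro i hi; fin_cases i <;> simp_all⟩
  · rw [h0, h2, zero_add, add_zero]
    exact n1.imp_right fun h => ⟨1, h.1, by intro i hi; fin_cases i <;> simp_all⟩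
  · left; rw [h0, zero_add]
    exact gain_zero_add_lt h1 h2 (two_le_norm_expand_add a (by decide))
  · rw [h1, h2, add_zero, add_zero]
    exact n0.imp_right fun h => ⟨0, h.1, by intro i hi; fin_cases i <;> simp_all⟩
  · left; rw [h1, add_zero]
    exact gain_zero_add_lt h0 h2 (two_le_norm_expand_add a (by decide))
  · left; rw [h2, add_zero]
    exact gain_zero_add_lt h0 h1 (two_le_norm_expand_add a (by decide))
  · left
    have hc := circumradius_bounds
    -- All three preimages are within distance `1.22` of the centroid, while the squares of these
    -- distances add up to at least `4`; so each distance is at least `1`.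
    have hs := four_le_sum_norm_expand_sq a
    have H : ∀ j, gain 0 (expand j a) ≠ 0 → ‖expand j a - center‖ ^ 2 < 1.4884 := by
      intro j hj
      have := lt_of_excessBound_pos (excessBound_pos_of_gain_ne_zero hj)
      exact (pow_lt_pow_left₀ this (norm_nonneg _) two_ne_zero).trans_eq (by norm_num)
    have G : ∀ j, gain 0 (expand j a) ≠ 0 → 1 ≤ ‖expand j a - center‖ ^ 2 →
        gain 0 (expand j a) < 0.0245 := by
      intro j hj h
      have h := (one_le_sq_iff₀ (norm_nonneg _)).1 h
      have e₁ := gain_zero_le_of_one_le h (excessBound_pos_of_gain_ne_zero hj).le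
      have e₂ := excessBound_le (by norm_num) h
      have e₃ : excessBound 1 < 0.23 := by unfold excessBound; linarith
      linarith
    have := H 0 h0
    have := H 1 h1
    have := H 2 h2
    linarith [G 0 h0 (by linarith), G 1 h1 (by linarith), G 2 h2 (by linarith)]

theorem norm_lt_of_norm_expand_lt {a : Plane} {j : Fin 3} (h : ‖expand j a - center‖ < 1.22) :
    ‖a - center‖ < 1 := by
  have e : (3 : ℝ) • (a - center) = (expand j a - center) + (2 : ℝ) • arm j := by
    rw [expand_sub_center]; module
  have h1 := norm_add_le (expand j a - center) ((2 : ℝ) • arm j)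
  rw [← e, norm_smul, norm_smul, norm_arm] at h1
  norm_num at h1
  have := circumradius_bounds
  linarith

/-- Points of positive gain stay close to `△`. -/
theorem norm_lt_of_gain_ne_zero {ℓ : ℕ} {a : Plane} (h : gain ℓ a ≠ 0) :
    ‖a - center‖ < 1.22 := by
  induction ℓ generalizing a with
  | zero => exact lt_of_excessBound_pos (excessBound_pos_of_gain_ne_zero h)
  | succ ℓ ih =>
    obtain ⟨j, -, hj⟩ := Finset.exists_ne_zero_of_sum_ne_zero (right_ne_zero_of_mul h)
    linarith [norm_lt_of_norm_expand_lt (ih hj)]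

theorem norm_lt_one_of_gain_ne_zero {ℓ : ℕ} {a : Plane} (h : gain (ℓ + 1) a ≠ 0) :
    ‖a - center‖ < 1 := by
  obtain ⟨j, -, hj⟩ := Finset.exists_ne_zero_of_sum_ne_zero (right_ne_zero_of_mul h)
  exact norm_lt_of_norm_expand_lt (norm_lt_of_gain_ne_zero hj)

/-- The maximal gain of a point at level `ℓ`. -/
def maxGain (ℓ : ℕ) : ℝ := 2 / 27 ^ (ℓ + 1)

theorem maxGain_zero : maxGain 0 = 2 / 27 := by norm_num [maxGain]

theorem maxGain_succ (ℓ : ℕ) : maxGain (ℓ + 1) = 1 / 27 * maxGain ℓ := by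
  rw [maxGain, maxGain, pow_succ _ (ℓ + 1)]; field_simp

theorem maxGain_pos (ℓ : ℕ) : 0 < maxGain ℓ := by unfold maxGain; positivity

theorem sum_gain_expand (ℓ : ℕ) (a : Plane) :
    ∑ j, gain ℓ (expand j a) < maxGain ℓ ∨
      ∃ j, gain ℓ (expand j a) = maxGain ℓ ∧ ∀ i, i ≠ j → gain ℓ (expand i a) = 0 := by
  induction ℓ generalizing a with
  | zero => rw [maxGain_zero]; exact sum_gain_zero_expand a
  | succ ℓ ih =>
    by_cases h : ∃ j, gain (ℓ + 1) (expand j a) ≠ 0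
    · obtain ⟨j, hj⟩ := h
      -- Points of positive gain are within distance `1` of the centroid, while distinct preimages
      -- of a point are at distance `2` from each other.
      have hz : ∀ i, i ≠ j → gain (ℓ + 1) (expand i a) = 0 := by
        intro i hi
        by_contra hi0
        have := norm_lt_one_of_gain_ne_zero hi0
        have := norm_lt_one_of_gain_ne_zero hj
        linarith [two_le_norm_expand_add a hi]
      rw [Finset.sum_eq_single j (fun i _ hi => hz i hi) (by simp), gain, maxGain_succ]
      rcases ih (expand j a) with h | ⟨i, hi, hi'⟩
      · left; linarith
      · right
        refine ⟨j, ?_, hz⟩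
        rw [gain, Finset.sum_eq_single i (fun i _ hi => hi' i hi) (by simp), hi]
    · push Not at h
      left
      rw [Finset.sum_eq_zero fun j _ => h j]
      exact maxGain_pos _

theorem gain_le (ℓ : ℕ) (a : Plane) : gain ℓ a ≤ maxGain ℓ := by
  cases ℓ with
  | zero => rw [maxGain_zero]; exact gain_zero_le a
  | succ ℓ =>
    rw [gain, maxGain_succ]
    rcases sum_gain_expand ℓ a with h | ⟨j, hj, h⟩
    · linarith
    · rw [Finset.sum_eq_single j (fun i _ hi => h i hi) (by simp), hj]

theorem exists_of_gain_succ_eq {ℓ : ℕ} {a : Plane} (h : gain (ℓ + 1) a = maxGain (ℓ + 1)) :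
    ∃ j, gain ℓ (expand j a) = maxGain ℓ ∧ ∀ i, i ≠ j → gain ℓ (expand i a) = 0 := by
  rcases sum_gain_expand ℓ a with h' | h'
  · rw [gain, maxGain_succ] at h
    linarith
  · exact h'

theorem isCellMean_of_gain_zero_eq {a : Plane} (h : gain 0 a = maxGain 0) : IsCellMean a := by
  rw [maxGain_zero] at h
  rcases gain_zero_lt_or a with h' | h'
  · linarith
  · exact h'.2

theorem norm_lt_of_isCellMean {a : Plane} (h : IsCellMean a) : ‖a - center‖ < 1 := by
  obtain ⟨k, t, ht, rfl⟩ := h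
  rw [add_sub_cancel_left, norm_smul, norm_arm]
  have := circumradius_bounds
  rcases ht with rfl | rfl | rfl <;> norm_num <;> linarith

/-- A centroid of a union of first level cells whose preimage is another such centroid is the
centroid of a single first level cell. -/
theorem expand_eq_center_of_isCellMean {a : Plane} {j : Fin 3} (h : IsCellMean a)
    (h' : IsCellMean (expand j a)) : expand j a = center := by
  obtain ⟨k, t, ht, rfl⟩ := h
  obtain ⟨k', t', ht', h'⟩ := h'
  rw [← sub_eq_iff_eq_add', expand_sub_center, add_sub_cancel_left, smul_smul] at h'
  have hn : ‖(3 * t) • arm k - (2 : ℝ) • arm j‖ ^ 2 = t' ^ 2 / 3 := by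
    rw [h', norm_smul, mul_pow, norm_arm_sq, Real.norm_eq_abs, sq_abs]; ring
  rw [norm_sub_sq_real, norm_smul, norm_smul, inner_smul_left, inner_smul_right, mul_pow, mul_pow,
    norm_arm_sq, norm_arm_sq, Real.norm_eq_abs, sq_abs, inner_arm] at hn
  simp only [conj_trivial] at hn
  have hn' : t' ^ 2 ≤ 4 / 9 := by rcases ht' with rfl | rfl | rfl <;> norm_num
  by_cases hkj : k = j
  · subst hkj
    rcases ht with rfl | rfl | rfl
    · norm_num at hn; linarith
    · rw [← sub_eq_zero, expand_sub_center, add_sub_cancel_left]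
      module
    · norm_num at hn; linarith
  · rw [if_neg hkj] at hn
    rcases ht with rfl | rfl | rfl <;> norm_num at hn <;> linarith

theorem wordMap_zero (ω : Word 0) (x : Plane) : wordMap ω x = x := rfl

theorem wordMap_succ {k : ℕ} (ω : Word (k + 1)) (x : Plane) :
    wordMap ω x = simMap (ω 0) (wordMap (Fin.tail ω) x) := by
  simp only [wordMap, List.ofFn_succ, List.foldr_cons]
  rfl

/-- A point whose gain is maximal at two consecutive levels is the image of the centroid under a
word map. -/
theorem exists_wordMap_of_gain_eq {ℓ : ℕ} {a : Plane} (h : gain ℓ a = maxGain ℓ)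
    (h' : gain (ℓ + 1) a = maxGain (ℓ + 1)) : ∃ ω : Word (ℓ + 1), a = wordMap ω center := by
  induction ℓ generalizing a with
  | zero =>
    obtain ⟨j, hj, -⟩ := exists_of_gain_succ_eq h'
    refine ⟨fun _ => j, ?_⟩
    rw [wordMap_succ, wordMap_zero, ← expand_eq_center_of_isCellMean
      (isCellMean_of_gain_zero_eq h) (isCellMean_of_gain_zero_eq hj), simMap_expand]
  | succ ℓ ih =>
    obtain ⟨j, hj, -⟩ := exists_of_gain_succ_eq h
    obtain ⟨i, hi, -⟩ := exists_of_gain_succ_eq h'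
    have hij : i = j := by
      by_contra hij
      have n1 := norm_lt_one_of_gain_ne_zero (a := expand i a)
        (by rw [hi]; exact (maxGain_pos _).ne')
      have n2 : ‖expand j a - center‖ < 1 := by
        cases ℓ with
        | zero => exact norm_lt_of_isCellMean (isCellMean_of_gain_zero_eq hj)
        | succ ℓ => exact norm_lt_one_of_gain_ne_zero (by rw [hj]; exact (maxGain_pos _).ne')
      linarith [two_le_norm_expand_add a hij]
    subst hij
    obtain ⟨ω, hω⟩ := ih hj hi
    refine ⟨Fin.cons i ω, ?_⟩
    rw [wordMap_succ, Fin.cons_zero, Fin.tail_cons, ← hω, simMap_expand]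

/-! ### Lower bounds for the distortion error -/

theorem continuous_iInf_norm_sq {ι : Type*} [Finite ι] [Nonempty ι] (a : ι → Plane) :
    Continuous fun x => ⨅ i, ‖x - a i‖ ^ 2 := by
  let _ := Fintype.ofFinite ι
  have : (fun x => ⨅ i, ‖x - a i‖ ^ 2) =
      fun x => Finset.univ.inf' Finset.univ_nonempty fun i => ‖x - a i‖ ^ 2 := by
    funext x
    rw [Finset.inf'_univ_eq_ciInf]
  rw [this]
  exact Continuous.finset_inf'_apply _ fun i _ => by fun_prop

theorem iInf_norm_sq_le {ι : Type*} [Finite ι] (a : ι → Plane) (x : Plane) (i : ι) :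
    ⨅ i, ‖x - a i‖ ^ 2 ≤ ‖x - a i‖ ^ 2 :=
  ciInf_le (Set.finite_range _).bddBelow i

theorem exists_iInf_norm_sq_eq {ι : Type*} [Finite ι] [Nonempty ι] (a : ι → Plane) (x : Plane) :
    ∃ i, ⨅ i, ‖x - a i‖ ^ 2 = ‖x - a i‖ ^ 2 := by
  obtain ⟨i, hi⟩ := exists_eq_ciInf_of_finite (f := fun i => ‖x - a i‖ ^ 2)
  exact ⟨i, hi.symm⟩

/-- The mean of the dual potential at level `ℓ`. -/
def potentialMean (ℓ : ℕ) : ℝ := 13 / 54 * (1 / 9) ^ ℓ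

theorem integral_potential : ∫ x, (2 / 27 + ‖x - center‖ ^ 2) ∂rMeasure = 13 / 54 := by
  rw [integral_add (integrable_const _) (integrable_of_continuous (by fun_prop)),
    integral_norm_sub_center_sq]
  norm_num

theorem integral_norm_sub_sq (a : Plane) :
    ∫ x, ‖x - a‖ ^ 2 ∂rMeasure = 1 / 6 + ‖a - center‖ ^ 2 := by
  have e : ∀ x, ‖x - a‖ ^ 2 = ‖x - center‖ ^ 2 +
      (‖a - center‖ ^ 2 + inner ℝ (x - center) ((-2 : ℝ) • (a - center))) := by
    intro x
    have := excess_eq a x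
    rw [excess] at this
    rw [inner_smul_right]; linarith
  simp only [e]
  rw [integral_add (integrable_of_continuous (by fun_prop))
    (integrable_of_continuous (by fun_prop)), integral_norm_sub_center_sq, integral_add_inner]

/-- The lower bound given by linear programming duality: since `min ‖x - aᵢ‖²` is at least
`u(x) - ∑ (u(x) - ‖x - aᵢ‖²)⁺` for every potential `u`, the distortion error of finitely many points
is at least the mean of the potential minus the sum of the gains of the points. -/
theorem potentialMean_sub_sum_gain_le (ℓ : ℕ) {ι : Type*} [Fintype ι] [Nonempty ι]
    (a : ι → Plane) :
    potentialMean ℓ - ∑ i, gain ℓ (a i) ≤ ∫ x, ⨅ i, ‖x - a i‖ ^ 2 ∂rMeasure := by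
  induction ℓ generalizing a with
  | zero =>
    have hi : ∀ i, Integrable (fun x => max 0 (excess (a i) x)) rMeasure := fun i =>
      integrable_of_continuous (continuous_const.max (continuous_excess _))
    have hc : Continuous fun x => ∑ i, max 0 (excess (a i) x) :=
      continuous_finsetSum _ fun i _ => continuous_const.max (continuous_excess _)
    have : ∫ x, (2 / 27 + ‖x - center‖ ^ 2 - ∑ i, max 0 (excess (a i) x)) ∂rMeasure ≤
        ∫ x, ⨅ i, ‖x - a i‖ ^ 2 ∂rMeasure := by
      refine integral_mono_of_continuous (Continuous.sub (by fun_prop) hc)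
        (continuous_iInf_norm_sq a) fun x _ => ?_
      obtain ⟨i, hi⟩ := exists_iInf_norm_sq_eq a x
      rw [hi]
      have h1 := Finset.single_le_sum (f := fun i => max 0 (excess (a i) x))
        (fun i _ => le_max_left _ _) (Finset.mem_univ i)
      have h2 := le_max_right 0 (excess (a i) x)
      simp only [excess] at h1 h2 ⊢
      linarith
    rw [integral_sub (integrable_of_continuous (by fun_prop)) (integrable_of_continuous hc),
      integral_potential, integral_finsetSum _ fun i _ => hi i] at this
    simpa [potentialMean, gain] using this
  | succ ℓ ih =>
    rw [integral_eq_sum_simMap (continuous_iInf_norm_sq a)]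
    have e : ∀ j, ∫ x, ⨅ i, ‖simMap j x - a i‖ ^ 2 ∂rMeasure =
        1 / 9 * ∫ x, ⨅ i, ‖x - expand j (a i)‖ ^ 2 ∂rMeasure := by
      intro j
      simp only [norm_simMap_sub]
      rw [← integral_const_mul]
      congr 1
      funext x
      rw [Real.mul_iInf_of_nonneg (by norm_num)]
    have hsum : ∑ i, gain (ℓ + 1) (a i) = 1 / 27 * ∑ j, ∑ i, gain ℓ (expand j (a i)) := by
      rw [Finset.sum_comm, Finset.mul_sum]
      rfl
    have hp : potentialMean (ℓ + 1) = 1 / 9 * potentialMean ℓ := by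
      rw [potentialMean, potentialMean, pow_succ]; ring
    rw [hsum, hp]
    simp only [e, Fin.sum_univ_three, smul_eq_mul]
    linarith [ih fun i => expand 0 (a i), ih fun i => expand 1 (a i), ih fun i => expand 2 (a i)]

/-- The lower bound for the `n`-th quantization error that is given by the potential at
level `ℓ`. -/
def errorBound (ℓ n : ℕ) : ℝ := potentialMean ℓ - n * maxGain ℓ

theorem errorBound_eq (ℓ n : ℕ) :
    errorBound ℓ n = 1 / 2 * (1 / 27 ^ (ℓ + 1)) * (13 * 3 ^ ℓ - 4 * (n : ℝ)) := by
  have h : (27 : ℝ) ^ ℓ = 9 ^ ℓ * 3 ^ ℓ := by rw [← mul_pow]; norm_num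
  rw [errorBound, potentialMean, maxGain, pow_succ, h, one_div_pow]
  field_simp
  ring

/-- The lower bounds of levels `ℓ` and `ℓ + 1` agree for `3 ^ (ℓ + 1)` points. -/
theorem errorBound_pow_succ (ℓ : ℕ) :
    errorBound (ℓ + 1) (3 ^ (ℓ + 1)) = errorBound ℓ (3 ^ (ℓ + 1)) := by
  rw [errorBound_eq, errorBound_eq]
  push_cast
  rw [pow_succ (27 : ℝ) (ℓ + 1), pow_succ (3 : ℝ) ℓ]
  field_simp
  ring

theorem finite_of_encard_le {α : Set Plane} {n : ℕ} (h : α.encard ≤ n) : α.Finite :=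
  Set.finite_of_encard_le_coe h

/-- If at most `n` points meet the lower bound, then there are exactly `n` of them and each one has
maximal gain. -/
theorem errorBound_le_distortion (ℓ : ℕ) {n : ℕ} {α : Set Plane} (h0 : α.Nonempty)
    (hn : α.encard ≤ n) : errorBound ℓ n ≤ distortion rMeasure α ∧
      (distortion rMeasure α = errorBound ℓ n →
        α.encard = n ∧ ∀ a ∈ α, gain ℓ a = maxGain ℓ) := by
  have hf := finite_of_encard_le hn
  let _ := hf.fintype
  have := h0.to_subtype
  have h := potentialMean_sub_sum_gain_le ℓ fun a : α => (a : Plane)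
  have hle : ∑ a : α, gain ℓ a ≤ ∑ _a : α, maxGain ℓ :=
    Finset.sum_le_sum fun a _ => gain_le ℓ a
  have hc : ∑ _a : α, maxGain ℓ = Fintype.card α * maxGain ℓ := by simp
  have hcard : α.encard = Fintype.card α := by
    rw [Set.encard_eq_coe_toFinset_card, Set.toFinset_card]
  rw [hcard] at hn ⊢
  norm_cast at hn ⊢
  have hn' : (Fintype.card α : ℝ) ≤ n := by exact_mod_cast hn
  have hm := mul_le_mul_of_nonneg_right hn' (maxGain_pos ℓ).le
  change potentialMean ℓ - _ ≤ distortion rMeasure α at h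
  refine ⟨by unfold errorBound; linarith, fun he => ?_⟩
  rw [errorBound] at he
  have he' : (Fintype.card α : ℝ) * maxGain ℓ = n * maxGain ℓ := by linarith
  refine ⟨by exact_mod_cast mul_right_cancel₀ (maxGain_pos ℓ).ne' he', fun a ha => ?_⟩
  have hs : ∑ a : α, gain ℓ a = ∑ _a : α, maxGain ℓ := by linarith
  exact (Finset.sum_eq_sum_iff_of_le fun (a : α) _ => gain_le ℓ a).1 hs ⟨a, ha⟩
    (Finset.mem_univ _)

/-- A set whose distortion error meets the lower bound is optimal. -/
theorem isOptimalSet_of_le {ℓ n : ℕ} {α : Set Plane} (h0 : α.Nonempty) (hn : α.encard ≤ n)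
    (h : distortion rMeasure α ≤ errorBound ℓ n) :
    quantError rMeasure n = errorBound ℓ n ∧ IsOptimalSet rMeasure n α := by
  have he : distortion rMeasure α = errorBound ℓ n :=
    le_antisymm h (errorBound_le_distortion ℓ h0 hn).1
  have : quantError rMeasure n = errorBound ℓ n := by
    refine IsLeast.csInf_eq ⟨⟨α, h0, hn, he.symm⟩, ?_⟩
    rintro v ⟨β, hβ, hβn, rfl⟩
    exact (errorBound_le_distortion ℓ hβ hβn).1
  exact ⟨this, h0, hn, he.trans this.symm⟩

/-! ### Cells -/

theorem bary_le_one {x : Plane} (hx : x ∈ triangle) (k : Fin 3) : bary k x ≤ 1 := by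
  rw [mem_triangle_iff] at hx
  have := sum_bary x
  have := hx 0
  have := hx 1
  have := hx 2
  fin_cases k <;> simp <;> linarith

theorem simMap_mem_triangle {x : Plane} (hx : x ∈ triangle) (j : Fin 3) :
    simMap j x ∈ triangle := by
  rw [mem_triangle_iff] at hx ⊢
  intro k
  rw [bary_simMap]
  have := hx k
  split_ifs <;> linarith

theorem wordMap_mem_triangle {k : ℕ} (ω : Word k) {x : Plane} (hx : x ∈ triangle) :
    wordMap ω x ∈ triangle := by
  induction k with
  | zero => rwa [wordMap_zero]
  | succ k ih => rw [wordMap_succ]; exact simMap_mem_triangle (ih _) _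

/-- The first level cells are disjoint. -/
theorem eq_of_simMap_eq {i j : Fin 3} {x y : Plane} (hx : x ∈ triangle) (hy : y ∈ triangle)
    (h : simMap i x = simMap j y) : i = j := by
  by_contra hij
  have h1 : bary i (simMap i x) = bary i (simMap j y) := by rw [h]
  rw [bary_simMap, bary_simMap, if_pos rfl, if_neg (Ne.symm hij)] at h1
  have := bary_le_one hy i
  have := (mem_triangle_iff x).1 hx i
  linarith

/-- Distinct cells of the same level are disjoint, and the word maps are injective. -/
theorem eq_of_wordMap_eq {k : ℕ} {ω τ : Word k} {x y : Plane} (hx : x ∈ triangle)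
    (hy : y ∈ triangle) (h : wordMap ω x = wordMap τ y) : ω = τ ∧ x = y := by
  induction k with
  | zero => exact ⟨Subsingleton.elim _ _, h⟩
  | succ k ih =>
    rw [wordMap_succ, wordMap_succ] at h
    have h0 := eq_of_simMap_eq (wordMap_mem_triangle _ hx) (wordMap_mem_triangle _ hy) h
    rw [h0] at h
    obtain ⟨h1, h2⟩ := ih (simMap_injective _ h)
    refine ⟨?_, h2⟩
    rw [← Fin.cons_self_tail ω, ← Fin.cons_self_tail τ, h0, h1]

theorem continuous_wordMap {k : ℕ} (ω : Word k) : Continuous (wordMap ω) := by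
  induction k with
  | zero => exact continuous_id
  | succ k ih =>
    have : wordMap ω = fun x => simMap (ω 0) (wordMap (Fin.tail ω) x) :=
      funext (wordMap_succ ω)
    rw [this]
    exact (continuous_simMap _).comp (ih _)

theorem norm_wordMap_sub {k : ℕ} (ω : Word k) (x y : Plane) :
    ‖wordMap ω x - wordMap ω y‖ ^ 2 = (1 / 9) ^ k * ‖x - y‖ ^ 2 := by
  induction k with
  | zero => simp [wordMap_zero]
  | succ k ih =>
    rw [wordMap_succ, wordMap_succ ω y, norm_simMap_sub, expand_simMap, ih, pow_succ]; ring

theorem integral_eq_sum_wordMap (k : ℕ) {f : Plane → ℝ} (hf : Continuous f) :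
    ∫ x, f x ∂rMeasure = (1 / 3) ^ k * ∑ ω : Word k, ∫ x, f (wordMap ω x) ∂rMeasure := by
  induction k generalizing f with
  | zero => simp [wordMap_zero]
  | succ k ih =>
    rw [integral_eq_sum_simMap hf, ← (Fin.consEquiv fun _ : Fin (k + 1) => Fin 3).sum_comp,
      Fintype.sum_prod_type, smul_eq_mul, pow_succ', mul_assoc, Finset.mul_sum (s := Finset.univ)
      (a := (1 / 3 : ℝ) ^ k)]
    congr 1
    refine Finset.sum_congr rfl fun j _ => ?_
    refine (ih (hf.comp (continuous_simMap j))).trans ?_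
    simp only [wordMap_succ, Fin.consEquiv_apply, Fin.cons_zero, Function.comp_apply]
    rfl

/-- The restriction of the R-measure to a cell is a scaled copy of the R-measure. -/
theorem restrict_cell {k : ℕ} (ω : Word k) :
    rMeasure.restrict (cell ω) = (3 : ℝ≥0∞)⁻¹ ^ k • rMeasure.map (wordMap ω) := by
  have hm : ∀ {k : ℕ} (ω : Word k), MeasurableSet (cell ω) := fun ω =>
    (isCompact_triangle.image (continuous_wordMap ω)).isClosed.measurableSet
  induction k with
  | zero =>
    have h1 : cell ω = triangle := by
      rw [cell, show wordMap ω = id from funext (wordMap_zero ω), image_id]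
    rw [h1, show wordMap ω = id from funext (wordMap_zero ω), Measure.map_id, pow_zero, one_smul]
    exact Measure.restrict_eq_self_of_ae_mem ae_mem_triangle
  | succ k ih =>
    set τ := Fin.tail ω
    have hw : wordMap ω = simMap (ω 0) ∘ wordMap τ := funext (wordMap_succ ω)
    have hc : cell ω = simMap (ω 0) '' cell τ := by rw [cell, hw, image_comp]; rfl
    have hsub : cell τ ⊆ triangle := by
      rintro _ ⟨x, hx, rfl⟩; exact wordMap_mem_triangle _ hx
    have hj : ∀ j, (rMeasure.map (simMap j)).restrict (cell ω) =
        if j = ω 0 then (rMeasure.restrict (cell τ)).map (simMap (ω 0)) else 0 := by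
      intro j
      rw [Measure.restrict_map (measurable_simMap j) (hm ω), hc]
      split_ifs with h
      · rw [h, preimage_image_eq _ (simMap_injective _)]
      · have : rMeasure (simMap j ⁻¹' (simMap (ω 0) '' cell τ)) = 0 := by
          refine measure_mono_null (t := triangleᶜ) ?_ (ae_iff.1 ae_mem_triangle)
          rintro x ⟨y, hy, hxy⟩ hx
          exact h (eq_of_simMap_eq hx (hsub hy) hxy.symm)
        rw [Measure.restrict_eq_zero.2 this, Measure.map_zero]
    conv_lhs => rw [rMeasure_selfSimilar]
    rw [Measure.restrict_smul, Fin.sum_univ_three, Measure.restrict_add, Measure.restrict_add,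
      ← Fin.sum_univ_three fun j => (rMeasure.map (simMap j)).restrict (cell ω)]
    simp only [hj, Finset.sum_ite_eq', Finset.mem_univ, if_true]
    rw [ih, Measure.map_smul, Measure.map_map (measurable_simMap _)
      (continuous_wordMap _).measurable, ← hw, smul_smul, pow_succ']

theorem integral_wordMap {k : ℕ} (ω : Word k) :
    ∫ x, wordMap ω x ∂rMeasure = wordMap ω center := by
  have hc : ∀ x : Plane, Integrable (fun _ : Plane => x) rMeasure := fun x => integrable_const x
  induction k with
  | zero =>
    simp only [wordMap_zero]
    refine ext_inner_right ℝ fun v => ?_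
    have hi : Integrable (fun x : Plane => x) rMeasure := integrable_of_continuous continuous_id
    have h := integral_inner_sub_center v
    have h2 : ∀ x : Plane, inner ℝ (x - center) v = inner ℝ v x - inner ℝ v center := by
      intro x; rw [inner_sub_left, real_inner_comm, real_inner_comm center]
    simp only [h2] at h
    rw [integral_sub (hi.const_inner v) (integrable_const _), integral_inner hi] at h
    rw [real_inner_comm, real_inner_comm v center]
    simpa [sub_eq_zero] using h
  | succ k ih =>
    simp only [wordMap_succ, simMap]
    have hi : Integrable (fun x => (1 / 3 : ℝ) • wordMap (Fin.tail ω) x) rMeasure :=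
      by
      have := continuous_wordMap (Fin.tail ω)
      exact integrable_of_continuous (by fun_prop)
    rw [integral_add hi (hc _), integral_smul, ih]
    simp

theorem centroid_eq {k : ℕ} (ω : Word k) : centroid ω = wordMap ω center := by
  rw [centroid, restrict_cell, average_eq, integral_smul_measure,
    integral_map (continuous_wordMap ω).measurable.aemeasurable (f := fun x => x)
      aestronglyMeasurable_id]
  have := Measure.isProbabilityMeasure_map (μ := rMeasure)
    (continuous_wordMap ω).measurable.aemeasurable
  simp only [integral_wordMap, measureReal_ennreal_smul_apply, probReal_univ, smul_smul]
  rw [mul_one, inv_mul_cancel₀, one_smul]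
  simp

/-! ### Sets assembled from sets in the cells -/

/-- The union of the copies `S_ω(β_ω)` over all words `ω` of length `k`. -/
def glue {k : ℕ} (β : Word k → Set Plane) : Set Plane := ⋃ ω, wordMap ω '' β ω

theorem glue_nonempty {k : ℕ} {β : Word k → Set Plane} (h : ∀ ω, (β ω).Nonempty) :
    (glue β).Nonempty := by
  obtain ⟨x, hx⟩ := h fun _ => 0
  exact ⟨wordMap (fun _ => 0) x, mem_iUnion.2 ⟨_, mem_image_of_mem _ hx⟩⟩

theorem glue_finite {k : ℕ} {β : Word k → Set Plane} (h : ∀ ω, (β ω).Finite) :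
    (glue β).Finite := Set.finite_iUnion fun ω => (h ω).image _

theorem encard_glue_le {k : ℕ} {β : Word k → Set Plane} {m : Word k → ℕ}
    (h : ∀ ω, (β ω).encard ≤ m ω) : (glue β).encard ≤ (∑ ω, m ω : ℕ) := by
  rw [glue]
  refine (Set.encard_iUnion_le_of_fintype _).trans ?_
  push_cast
  exact Finset.sum_le_sum fun ω _ => (Set.encard_image_le _ _).trans (h ω)

theorem distortion_glue_le {k : ℕ} {β : Word k → Set Plane} (hf : ∀ ω, (β ω).Finite)
    (h0 : ∀ ω, (β ω).Nonempty) :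
    distortion rMeasure (glue β) ≤ (1 / 27) ^ k * ∑ ω, distortion rMeasure (β ω) := by
  have := (glue_nonempty h0).to_subtype
  have := (glue_finite hf).to_subtype
  unfold distortion
  rw [integral_eq_sum_wordMap k (continuous_iInf_norm_sq _),
    show (1 / 27 : ℝ) = 1 / 3 * (1 / 9) by norm_num, mul_pow, mul_assoc]
  refine mul_le_mul_of_nonneg_left ?_ (by positivity)
  rw [Finset.mul_sum]
  refine Finset.sum_le_sum fun ω _ => ?_
  have := (h0 ω).to_subtype
  have := (hf ω).to_subtype
  rw [← integral_const_mul]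
  refine integral_mono_of_continuous ((continuous_iInf_norm_sq _).comp (continuous_wordMap ω))
    (continuous_const.mul (continuous_iInf_norm_sq _)) fun x _ => ?_
  obtain ⟨⟨b, hb⟩, he⟩ := exists_iInf_norm_sq_eq (fun b : β ω => (b : Plane)) x
  rw [he, ← norm_wordMap_sub]
  exact iInf_norm_sq_le (fun a : glue β => (a : Plane)) _
    ⟨wordMap ω b, mem_iUnion.2 ⟨ω, mem_image_of_mem _ hb⟩⟩

/-- If every `β_ω` has at most `m_ω` points and its distortion error is at most
`(13 - 4 m_ω) / 54`, which is the quantization error of order `m_ω` for `m_ω ≤ 3`, then the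
union of the copies `S_ω(β_ω)` is optimal. -/
theorem isOptimalSet_glue {ℓ n : ℕ} {β : Word ℓ → Set Plane} {m : Word ℓ → ℕ}
    (h0 : ∀ ω, (β ω).Nonempty) (hm : ∀ ω, (β ω).encard ≤ m ω)
    (hd : ∀ ω, distortion rMeasure (β ω) ≤ errorBound 0 (m ω)) (hn : ∑ ω, m ω = n) :
    quantError rMeasure n = errorBound ℓ n ∧ IsOptimalSet rMeasure n (glue β) := by
  refine isOptimalSet_of_le (glue_nonempty h0) (hn ▸ encard_glue_le hm) ?_
  refine (distortion_glue_le (fun ω => finite_of_encard_le (hm ω)) h0).trans ?_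
  have := mul_le_mul_of_nonneg_left (Finset.sum_le_sum fun ω (_ : ω ∈ Finset.univ) => hd ω)
    (by positivity : (0 : ℝ) ≤ (1 / 27) ^ ℓ)
  refine this.trans_eq ?_
  simp only [errorBound_eq, pow_zero, mul_one, ← Finset.mul_sum, Finset.sum_sub_distrib]
  rw [← Nat.cast_sum, hn]
  simp
  ring

theorem distortion_singleton_center : distortion rMeasure {center} = errorBound 0 1 := by
  have : distortion rMeasure {center} = ∫ x, ‖x - center‖ ^ 2 ∂rMeasure := by
    unfold distortion; congr 1; funext x; simp
  rw [this, integral_norm_sub_center_sq, errorBound_eq]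
  norm_num

theorem range_centroid_eq_glue (ℓ : ℕ) :
    (Set.range fun ω : Word ℓ => centroid ω) = glue fun _ : Word ℓ => {center} := by
  ext x
  simp [glue, centroid_eq, eq_comm]

theorem isOptimalSet_range_centroid (ℓ : ℕ) :
    quantError rMeasure (3 ^ ℓ) = errorBound ℓ (3 ^ ℓ) ∧
      IsOptimalSet rMeasure (3 ^ ℓ) (Set.range fun ω : Word ℓ => centroid ω) := by
  rw [range_centroid_eq_glue]
  exact isOptimalSet_glue (m := fun _ => 1) (fun _ => singleton_nonempty _) (fun _ => by simp)
    (fun _ => distortion_singleton_center.le) (by simp)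

/-- The centroids of the cells of level `ℓ ≥ 1` are the only optimal set of `3 ^ ℓ`-means: the
lower bounds of levels `ℓ - 1` and `ℓ` agree for this number of points, hence every point of an
optimal set has maximal gain at both levels. -/
theorem isOptimalSet_pow_iff {ℓ : ℕ} (hℓ : ℓ ≠ 0) (α : Set Plane) :
    IsOptimalSet rMeasure (3 ^ ℓ) α ↔ α = Set.range fun ω : Word ℓ => centroid ω := by
  constructor
  · rintro ⟨h0, hn, hd⟩
    obtain ⟨k, rfl⟩ := Nat.exists_eq_succ_of_ne_zero hℓ
    rw [(isOptimalSet_range_centroid _).1] at hd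
    obtain ⟨hc, h1⟩ := (errorBound_le_distortion (k + 1) h0 hn).2 hd
    obtain ⟨-, h2⟩ := (errorBound_le_distortion k h0 hn).2 (hd.trans (errorBound_pow_succ k))
    have hsub : α ⊆ Set.range fun ω : Word (k + 1) => centroid ω := by
      intro a ha
      obtain ⟨ω, hω⟩ := exists_wordMap_of_gain_eq (h2 a ha) (h1 a ha)
      exact ⟨ω, by rw [hω]; exact centroid_eq ω⟩
    refine (finite_of_encard_le hn).eq_of_subset_of_encard_le hsub ?_
    rw [hc, ← Set.image_univ]
    refine (Set.encard_image_le _ _).trans ?_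
    simp
  · rintro rfl
    exact (isOptimalSet_range_centroid ℓ).2

/-! ### Optimal sets of two-means -/

/-- The centroid of the `k`-th first level cell together with the centroid of the union of the
other two. -/
def twoMeans (k : Fin 3) : Set Plane :=
  {center + (2 / 3 : ℝ) • arm k, center + (-1 / 3 : ℝ) • arm k}

theorem isOptimalSet_twoMeans (k : Fin 3) :
    quantError rMeasure 2 = errorBound 0 2 ∧ IsOptimalSet rMeasure 2 (twoMeans k) := by
  refine isOptimalSet_of_le (Set.insert_nonempty _ _) ?_ ?_
  · exact (Set.encard_insert_le _ _).trans (by rw [Set.encard_singleton]; norm_num)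
  have hf : (twoMeans k).Finite := by unfold twoMeans; exact Set.toFinite _
  have : Nonempty (twoMeans k) := (Set.insert_nonempty _ _).to_subtype
  have := hf.to_subtype
  have hj : ∀ j, ∫ x, ⨅ a : twoMeans k, ‖simMap j x - a‖ ^ 2 ∂rMeasure ≤
      if j = k then 1 / 54 else 7 / 54 := by
    intro j
    have key : ∀ t : ℝ, center + t • arm k ∈ twoMeans k →
        ∫ x, ⨅ a : twoMeans k, ‖simMap j x - a‖ ^ 2 ∂rMeasure ≤
          1 / 9 * (1 / 6 + (3 * t ^ 2 + 4 / 3 - 12 * t * inner ℝ (arm k) (arm j))) := by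
      intro t ht
      have hn : ‖expand j (center + t • arm k) - center‖ ^ 2 =
          3 * t ^ 2 + 4 / 3 - 12 * t * inner ℝ (arm k) (arm j) := by
        rw [expand_sub_center, add_sub_cancel_left, smul_smul, norm_sub_sq_real, norm_smul,
          norm_smul, inner_smul_left, inner_smul_right, mul_pow, mul_pow, norm_arm_sq,
          norm_arm_sq, Real.norm_eq_abs, sq_abs]
        norm_num
        ring
      rw [← hn, ← integral_norm_sub_sq, ← integral_const_mul]
      refine integral_mono_of_continuous ((continuous_iInf_norm_sq _).comp (continuous_simMap j))
        (by fun_prop) fun x _ => ?_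
      rw [← norm_simMap_sub]
      exact iInf_norm_sq_le (fun a : twoMeans k => (a : Plane)) _ ⟨_, ht⟩
    split_ifs with h
    · refine (key (2 / 3) (by simp [twoMeans])).trans ?_
      rw [inner_arm, if_pos h.symm]; norm_num
    · refine (key (-1 / 3) (by simp [twoMeans])).trans ?_
      rw [inner_arm, if_neg (Ne.symm h)]; norm_num
  unfold distortion
  rw [integral_eq_sum_simMap (continuous_iInf_norm_sq _), smul_eq_mul]
  have := Finset.sum_le_sum fun j (_ : j ∈ Finset.univ) => hj j
  refine (mul_le_mul_of_nonneg_left this (by norm_num)).trans ?_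
  have h3 : ∀ k : Fin 3, (∑ j, if j = k then (1 / 54 : ℝ) else 7 / 54) = 15 / 54 := by
    intro k
    rw [Finset.sum_ite, Finset.sum_const, Finset.sum_const, Finset.filter_eq' _ k,
      Finset.filter_ne' _ k, if_pos (Finset.mem_univ _), Finset.card_erase_of_mem
      (Finset.mem_univ _)]
    norm_num
  rw [errorBound_eq, h3]
  norm_num

/-- The vertices of `△` belong to the support of the R-measure. -/
theorem eq_zero_at_vertex {f : Plane → ℝ} (hf : Continuous f) (h0 : ∀ x ∈ triangle, 0 ≤ f x)
    (hi : ∫ x, f x ∂rMeasure = 0) (k : Fin 3) : f (vertex k) = 0 := by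
  have hmem : ∀ m x, x ∈ triangle → (simMap k)^[m] x ∈ triangle := by
    intro m x hx
    induction m with
    | zero => exact hx
    | succ m ih => rw [Function.iterate_succ_apply']; exact simMap_mem_triangle ih k
  have hcont : ∀ m, Continuous fun x => f ((simMap k)^[m] x) := fun m =>
    hf.comp ((continuous_simMap k).iterate m)
  have hz : ∀ m, ∫ x, f ((simMap k)^[m] x) ∂rMeasure = 0 := by
    intro m
    induction m with
    | zero => exact hi
    | succ m ih =>
      rw [integral_eq_sum_simMap (hcont m), smul_eq_mul, mul_eq_zero] at ih
      have ih := ih.resolve_left (by norm_num)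
      rw [Finset.sum_eq_zero_iff_of_nonneg] at ih
      · exact ih k (Finset.mem_univ _)
      · intro j _
        refine integral_nonneg_of_ae ?_
        filter_upwards [ae_mem_triangle] with x hx
          using h0 _ (hmem _ _ (simMap_mem_triangle hx j))
  obtain ⟨C, hC⟩ := isCompact_triangle.exists_bound_of_continuousOn hf.continuousOn
  have hit : ∀ m x, (simMap k)^[m] x = vertex k + (1 / 3 : ℝ) ^ m • (x - vertex k) := by
    intro m x
    induction m with
    | zero => simp
    | succ m ih => rw [Function.iterate_succ_apply', ih, simMap, pow_succ']; module
  have hlim := tendsto_integral_of_dominated_convergence (μ := rMeasure)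
    (F := fun m x => f ((simMap k)^[m] x)) (f := fun _ => f (vertex k)) (fun _ => C)
    (fun m => (hcont m).aestronglyMeasurable) (integrable_const _)
    (fun m => by
      filter_upwards [ae_mem_triangle] with x hx using hC _ (hmem m x hx))
    (ae_of_all _ fun x => by
      refine (hf.tendsto _).comp ?_
      simp only [hit]
      have := (tendsto_pow_atTop_nhds_zero_of_lt_one (r := (1 / 3 : ℝ)) (by norm_num)
        (by norm_num)).smul_const (x - vertex k)
      rw [zero_smul] at this
      simpa using this.const_add (vertex k))
  simp only [hz, integral_const, probReal_univ, one_smul] at hlim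
  exact tendsto_nhds_unique hlim tendsto_const_nhds

theorem excess_vertex (k i : Fin 3) (t : ℝ) :
    excess (center + t • arm k) (vertex i) =
      2 / 27 - t ^ 2 / 3 + 2 * t * if k = i then 1 / 3 else -1 / 6 := by
  rw [excess_eq, add_sub_cancel_left, ← arm, inner_smul_right, norm_smul, mul_pow, norm_arm_sq,
    Real.norm_eq_abs, sq_abs, ← inner_arm, real_inner_comm]
  ring

/-- For an optimal set `{a, b}` of two-means the duality gap vanishes on the support of the
R-measure, hence `excess a` and `excess b` are neither both positive nor both negative at a
vertex. -/
theorem excess_vertex_of_isOptimalSet {a b : Plane}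
    (hd : distortion rMeasure {a, b} = errorBound 0 2) (ga : gain 0 a = maxGain 0)
    (gb : gain 0 b = maxGain 0) (i : Fin 3) :
    (0 < excess a (vertex i) → 0 < excess b (vertex i) → False) ∧
      (excess a (vertex i) < 0 → excess b (vertex i) < 0 → False) := by
  have : Finite ({a, b} : Set Plane) := Set.toFinite _
  have : Nonempty ({a, b} : Set Plane) := (Set.insert_nonempty _ _).to_subtype
  have hcont : ∀ e : Plane, Continuous fun x => max 0 (excess e x) := fun e =>
    continuous_const.max (continuous_excess e)
  have hm : Continuous fun x : Plane => ⨅ e : ({a, b} : Set Plane), ‖x - (e : Plane)‖ ^ 2 :=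
    continuous_iInf_norm_sq fun e : ({a, b} : Set Plane) => (e : Plane)
  have hu : Continuous fun x : Plane => 2 / 27 + ‖x - center‖ ^ 2 := by fun_prop
  have hf : Continuous fun x : Plane => (⨅ e : ({a, b} : Set Plane), ‖x - (e : Plane)‖ ^ 2) -
      (2 / 27 + ‖x - center‖ ^ 2) + (max 0 (excess a x) + max 0 (excess b x)) :=
    (hm.sub hu).add ((hcont a).add (hcont b))
  have hi : ∫ x, ((⨅ e : ({a, b} : Set Plane), ‖x - (e : Plane)‖ ^ 2) -
      (2 / 27 + ‖x - center‖ ^ 2) + (max 0 (excess a x) + max 0 (excess b x))) ∂rMeasure = 0 := by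
    have h1 : Continuous fun x : Plane => (⨅ e : ({a, b} : Set Plane), ‖x - (e : Plane)‖ ^ 2) -
      (2 / 27 + ‖x - center‖ ^ 2) := hm.sub hu
    have h2 : Continuous fun x => max 0 (excess a x) + max 0 (excess b x) :=
      (hcont a).add (hcont b)
    rw [integral_add (integrable_of_continuous h1) (integrable_of_continuous h2),
      integral_sub (integrable_of_continuous hm) (integrable_of_continuous hu),
      integral_add (integrable_of_continuous (hcont a)) (integrable_of_continuous (hcont b)),
      integral_potential]
    change distortion rMeasure {a, b} - 13 / 54 + (gain 0 a + gain 0 b) = 0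
    rw [hd, ga, gb, errorBound, potentialMean]
    push_cast
    ring
  have hex : ∀ x : Plane, ∃ e, (e = a ∨ e = b) ∧
      (⨅ e : ({a, b} : Set Plane), ‖x - (e : Plane)‖ ^ 2) -
      (2 / 27 + ‖x - center‖ ^ 2) = -excess e x := by
    intro x
    obtain ⟨⟨e, he⟩, h⟩ := exists_iInf_norm_sq_eq (fun e : ({a, b} : Set Plane) => (e : Plane)) x
    refine ⟨e, he, ?_⟩
    rw [h, excess]
    ring
  have hv := eq_zero_at_vertex hf (fun x _ => by
    obtain ⟨e, he, h⟩ := hex x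
    rw [h]
    have := le_max_left 0 (excess a x)
    have := le_max_left 0 (excess b x)
    have := le_max_right 0 (excess a x)
    have := le_max_right 0 (excess b x)
    rcases he with rfl | rfl <;> linarith) hi i
  obtain ⟨e, he, h⟩ := hex (vertex i)
  rw [h] at hv
  constructor <;> intro h1 h2
  · rw [max_eq_right h1.le, max_eq_right h2.le] at hv
    rcases he with rfl | rfl <;> linarith
  · rw [max_eq_left h1.le, max_eq_left h2.le] at hv
    rcases he with rfl | rfl <;> linarith

/-- The only optimal sets of two-means are those formed by the centroid of a first level cell and
the centroid of the union of the other two. -/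
theorem isOptimalSet_two_iff (α : Set Plane) :
    IsOptimalSet rMeasure 2 α ↔ ∃ k, α = twoMeans k := by
  constructor
  · rintro ⟨h0, hn, hd⟩
    rw [(isOptimalSet_twoMeans 0).1] at hd
    obtain ⟨hc, hg⟩ := (errorBound_le_distortion 0 h0 hn).2 hd
    obtain ⟨a, b, -, rfl⟩ := Set.encard_eq_two.1 hc
    have ga := hg a (by simp)
    have gb := hg b (by simp)
    have hsign := excess_vertex_of_isOptimalSet hd ga gb
    obtain ⟨k, s, hs, rfl⟩ := isCellMean_of_gain_zero_eq ga
    obtain ⟨l, t, ht, rfl⟩ := isCellMean_of_gain_zero_eq gb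
    clear hd hn hc h0 hg ga gb
    simp only [excess_vertex] at hsign
    have hthird : ∀ k l : Fin 3, ∃ i, k ≠ i ∧ l ≠ i := by decide
    obtain ⟨i, hki, hli⟩ := hthird k l
    obtain ⟨pi, ni⟩ := hsign i
    obtain ⟨pk, nk⟩ := hsign k
    obtain ⟨pl, nl⟩ := hsign l
    clear hsign
    rw [if_neg hki, if_neg hli] at pi ni
    rw [if_pos rfl] at pk nk pl nl
    by_cases hkl : k = l
    · subst hkl
      rw [if_pos rfl] at pk nk
      rcases hs with rfl | rfl | rfl <;> rcases ht with rfl | rfl | rfl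
      · exact (pi (by norm_num) (by norm_num)).elim
      · exact (pk (by norm_num) (by norm_num)).elim
      · exact (pi (by norm_num) (by norm_num)).elim
      · exact (pk (by norm_num) (by norm_num)).elim
      · exact (pk (by norm_num) (by norm_num)).elim
      · exact ⟨k, rfl⟩
      · exact (pi (by norm_num) (by norm_num)).elim
      · exact ⟨k, Set.pair_comm _ _⟩
      · exact (pi (by norm_num) (by norm_num)).elim
    · rw [if_neg (Ne.symm hkl)] at pk nk
      rw [if_neg hkl] at pl nl
      rcases hs with rfl | rfl | rfl <;> rcases ht with rfl | rfl | rfl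
      · exact (pi (by norm_num) (by norm_num)).elim
      · exact (pl (by norm_num) (by norm_num)).elim
      · exact (pi (by norm_num) (by norm_num)).elim
      · exact (pk (by norm_num) (by norm_num)).elim
      · exact (ni (by norm_num) (by norm_num)).elim
      · exact (nl (by norm_num) (by norm_num)).elim
      · exact (pi (by norm_num) (by norm_num)).elim
      · exact (nk (by norm_num) (by norm_num)).elim
      · exact (pi (by norm_num) (by norm_num)).elim
  · rintro ⟨k, rfl⟩
    exact (isOptimalSet_twoMeans k).2

/-! ### Counting the assembled sets -/

theorem twoMeans_subset (k : Fin 3) : twoMeans k ⊆ triangle := by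
  have h : ∀ t : ℝ, t = 2 / 3 ∨ t = -1 / 3 → center + t • arm k ∈ triangle := by
    intro t ht
    rw [mem_triangle_iff]
    intro i
    rw [bary, add_sub_cancel_left, inner_smul_right, inner_arm]
    rcases ht with rfl | rfl <;> split_ifs <;> norm_num
  rintro x (rfl | rfl)
  · exact h _ (Or.inl rfl)
  · exact h _ (Or.inr rfl)

theorem smul_arm_eq {k l : Fin 3} {s t : ℝ} (hs : s ≠ 0) (h : s • arm k = t • arm l) :
    k = l ∧ s = t := by
  have h1 : inner ℝ (arm k) (s • arm k) = inner ℝ (arm k) (t • arm l) := by rw [h]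
  have h2 : inner ℝ (arm l) (s • arm k) = inner ℝ (arm l) (t • arm l) := by rw [h]
  simp only [inner_smul_right, inner_arm] at h1 h2
  by_cases hkl : k = l
  · subst hkl
    simp only [if_true] at h1
    exact ⟨rfl, by linarith⟩
  · simp only [if_true, if_neg hkl, if_neg (Ne.symm hkl)] at h1 h2
    exact absurd (by linarith) hs

theorem twoMeans_injective : Function.Injective twoMeans := by
  intro k l h
  have h1 : center + (2 / 3 : ℝ) • arm k ∈ twoMeans l := by rw [← h]; simp [twoMeans]
  rcases h1 with h1 | h1
  · exact (smul_arm_eq (by norm_num) (add_left_cancel h1)).1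
  · exact (smul_arm_eq (by norm_num) (add_left_cancel h1)).1

theorem ncard_twoMeans (k : Fin 3) : (twoMeans k).ncard = 2 := by
  refine Set.ncard_pair fun h => ?_
  have := (smul_arm_eq (by norm_num) (add_left_cancel h)).2
  norm_num at this

/-- The optimal sets of two-means. -/
def twoMeansSets : Finset (Set Plane) := Finset.univ.map ⟨twoMeans, twoMeans_injective⟩

theorem mem_twoMeansSets {α : Set Plane} :
    α ∈ twoMeansSets ↔ IsOptimalSet rMeasure 2 α := by
  rw [isOptimalSet_two_iff]
  simp [twoMeansSets, eq_comm]

theorem card_twoMeansSets : twoMeansSets.card = 3 := by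
  simp [twoMeansSets]

/-- The unique optimal set of three-means. -/
def threeMeans : Set Plane := Set.range fun ω : Word 1 => centroid ω

theorem isOptimalSet_three_iff (α : Set Plane) :
    IsOptimalSet rMeasure 3 α ↔ α = threeMeans :=
  isOptimalSet_pow_iff one_ne_zero α

theorem quantError_three : quantError rMeasure 3 = errorBound 0 3 :=
  (isOptimalSet_range_centroid 1).1.trans (errorBound_pow_succ 0)

theorem center_mem_triangle : center ∈ triangle := by
  rw [mem_triangle_iff]; intro k; simp [bary]

theorem threeMeans_subset : threeMeans ⊆ triangle := by
  rintro _ ⟨ω, rfl⟩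
  simp only [centroid_eq]
  exact wordMap_mem_triangle ω center_mem_triangle

theorem ncard_threeMeans : threeMeans.ncard = 3 := by
  rw [threeMeans, ← Set.image_univ, Set.ncard_image_of_injective]
  · simp
  · intro ω τ h
    simp only [centroid_eq] at h
    exact (eq_of_wordMap_eq center_mem_triangle center_mem_triangle h).1

/-- The cells are disjoint, so a set glued from subsets of `△` determines these subsets. -/
theorem glue_injOn {k : ℕ} : Set.InjOn (glue (k := k)) {β | ∀ ω, β ω ⊆ triangle} := by
  have h : ∀ β τ : Word k → Set Plane, (∀ ω, β ω ⊆ triangle) → (∀ ω, τ ω ⊆ triangle) →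
      glue β = glue τ → ∀ ω, β ω ⊆ τ ω := by
    intro β τ hβ hτ he ω x hx
    have h1 : wordMap ω x ∈ glue τ := by
      rw [← he]; exact mem_iUnion.2 ⟨ω, mem_image_of_mem _ hx⟩
    obtain ⟨ω', y, hy, hxy⟩ := mem_iUnion.1 h1
    obtain ⟨rfl, rfl⟩ := eq_of_wordMap_eq (hτ _ hy) (hβ _ hx) hxy
    exact hy
  intro β hβ τ hτ he
  exact funext fun ω => (h β τ hβ hτ he ω).antisymm (h τ β hτ hβ he.symm ω)

/-- The number of functions on a finite type that take a value in `A` at exactly `j` points and a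
value in the disjoint set `B` at the others. -/
theorem card_biUnion_piFinset {W X : Type*} [Fintype W] [DecidableEq W] [DecidableEq X]
    (A B : Finset X) (hAB : Disjoint A B) (j : ℕ) :
    ((Finset.univ.powersetCard j).biUnion fun J : Finset W =>
      Fintype.piFinset fun ω => if ω ∈ J then A else B).card =
      (Fintype.card W).choose j * (A.card ^ j * B.card ^ (Fintype.card W - j)) := by
  rw [Finset.card_biUnion]
  · rw [Finset.sum_congr rfl (g := fun _ => A.card ^ j * B.card ^ (Fintype.card W - j))]
    · simp [Finset.card_powersetCard]
    · intro J hJ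
      have hJ := (Finset.mem_powersetCard.1 hJ).2
      rw [Fintype.card_piFinset]
      simp only [apply_ite Finset.card]
      rw [Finset.prod_ite, Finset.prod_const, Finset.prod_const]
      have h1 : (Finset.univ.filter fun ω => ω ∈ J) = J := by ext; simp
      have h2 : (Finset.univ.filter fun ω => ω ∉ J) = Jᶜ := by ext; simp
      rw [h1, h2, Finset.card_compl, hJ]
  · intro J _ K _ hJK
    rw [Function.onFun, Finset.disjoint_left]
    intro f hf hf'
    refine hJK (Finset.ext fun ω => ?_)
    have h1 := Fintype.mem_piFinset.1 hf ω
    have h2 := Fintype.mem_piFinset.1 hf' ω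
    have hd := Finset.disjoint_left.1 hAB
    by_cases hJ : ω ∈ J <;> by_cases hK : ω ∈ K <;> simp only [hJ, hK, if_true, if_false] at h1 h2
    · simp [hJ, hK]
    · exact (hd h1 h2).elim
    · exact (hd h2 h1).elim
    · simp [hJ, hK]

/-- The sets that are assembled from members of `A` in exactly `j` cells of level `ℓ` and members
of `B` in the other cells. -/
def glueFamily (ℓ j : ℕ) (A B : Finset (Set Plane)) : Set (Set Plane) :=
  {α | ∃ (J : Finset (Word ℓ)) (β : Word ℓ → Set Plane), J.card = j ∧
    (∀ ω, β ω ∈ if ω ∈ J then A else B) ∧ α = glue β}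

theorem ncard_glueFamily (ℓ j : ℕ) {A B : Finset (Set Plane)} (hAB : Disjoint A B)
    (hA : ∀ s ∈ A, s ⊆ triangle) (hB : ∀ s ∈ B, s ⊆ triangle) :
    (glueFamily ℓ j A B).ncard =
      (3 ^ ℓ).choose j * (A.card ^ j * B.card ^ (3 ^ ℓ - j)) := by
  classical
  have e : glueFamily ℓ j A B = glue '' (((Finset.univ.powersetCard j).biUnion
      fun J : Finset (Word ℓ) => Fintype.piFinset fun ω => if ω ∈ J then A else B :
        Finset (Word ℓ → Set Plane)) : Set (Word ℓ → Set Plane)) := by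
    ext α
    simp only [glueFamily, mem_ofPred_eq, mem_image, Finset.coe_biUnion, mem_iUnion,
      Finset.mem_coe, Finset.mem_powersetCard_univ, Fintype.mem_piFinset]
    constructor
    · rintro ⟨J, β, hJ, hβ, rfl⟩
      exact ⟨β, ⟨J, hJ, hβ⟩, rfl⟩
    · rintro ⟨β, ⟨J, hJ, hβ⟩, rfl⟩
      exact ⟨J, β, hJ, hβ, rfl⟩
  have hinj : Set.InjOn glue (((Finset.univ.powersetCard j).biUnion
      fun J : Finset (Word ℓ) => Fintype.piFinset fun ω => if ω ∈ J then A else B :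
        Finset (Word ℓ → Set Plane)) : Set (Word ℓ → Set Plane)) := by
    refine glue_injOn.mono ?_
    intro β hβ ω
    simp only [Finset.coe_biUnion, mem_iUnion, Finset.mem_coe, Fintype.mem_piFinset] at hβ
    obtain ⟨J, -, hβ⟩ := hβ
    have := hβ ω
    split_ifs at this
    · exact hA _ this
    · exact hB _ this
  rw [e, hinj.ncard_image, Set.ncard_coe_finset, card_biUnion_piFinset A B hAB]
  simp

/-- If the members of `A` and `B` attain the lower bounds for `p` and `q` points, then the sets
assembled from them attain the lower bound for `p j + q (3 ^ ℓ - j)` points. -/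
theorem isOptimalSet_of_mem_glueFamily {ℓ j p q n : ℕ} {A B : Finset (Set Plane)}
    (hA : ∀ s ∈ A, IsOptimalSet rMeasure p s) (hp : quantError rMeasure p = errorBound 0 p)
    (hB : ∀ s ∈ B, IsOptimalSet rMeasure q s) (hq : quantError rMeasure q = errorBound 0 q)
    (hn : j * p + (3 ^ ℓ - j) * q = n) {α : Set Plane} (hα : α ∈ glueFamily ℓ j A B) :
    quantError rMeasure n = errorBound ℓ n ∧ IsOptimalSet rMeasure n α := by
  classical
  obtain ⟨J, β, hJ, hβ, rfl⟩ := hα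
  have h : ∀ ω, IsOptimalSet rMeasure (if ω ∈ J then p else q) (β ω) ∧
      quantError rMeasure (if ω ∈ J then p else q) = errorBound 0 (if ω ∈ J then p else q) := by
    intro ω
    have := hβ ω
    split_ifs at this ⊢
    · exact ⟨hA _ this, hp⟩
    · exact ⟨hB _ this, hq⟩
  refine isOptimalSet_glue (m := fun ω => if ω ∈ J then p else q) (fun ω => (h ω).1.1)
    (fun ω => (h ω).1.2.1) (fun ω => ((h ω).1.2.2.trans (h ω).2).le) ?_
  rw [Finset.sum_ite, Finset.sum_const, Finset.sum_const]
  have h1 : (Finset.univ.filter fun ω => ω ∈ J) = J := by ext; simp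
  have h2 : (Finset.univ.filter fun ω => ω ∉ J) = Jᶜ := by ext; simp
  rw [h1, h2, Finset.card_compl, hJ, ← hn]
  simp

theorem glueFamily_nonempty {ℓ j : ℕ} {A B : Finset (Set Plane)} (hj : j ≤ 3 ^ ℓ)
    (hA : A.Nonempty) (hB : B.Nonempty) : (glueFamily ℓ j A B).Nonempty := by
  classical
  obtain ⟨J, -, hJ⟩ := Finset.exists_subset_card_eq
    (s := (Finset.univ : Finset (Word ℓ))) (n := j) (by simpa using hj)
  obtain ⟨a, ha⟩ := hA
  obtain ⟨b, hb⟩ := hB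
  refine ⟨_, J, fun ω => if ω ∈ J then a else b, hJ, fun ω => ?_, rfl⟩
  by_cases hω : ω ∈ J
  · simpa only [if_pos hω] using ha
  · simpa only [if_neg hω] using hb

/-- The centroids `a(ω)` are the images `S_ω(c)` of the unique optimal set `{c}` of one-means. -/
theorem lowerFamily_eq (ℓ n : ℕ) :
    lowerFamily ℓ n = glueFamily ℓ (n - 3 ^ ℓ) twoMeansSets {{center}} := by
  classical
  have hl : ∀ (J : Finset (Word ℓ)) (β : Word ℓ → Set Plane),
      lowerSet J β = glue fun ω => if ω ∈ J then β ω else {center} := by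
    intro J β
    ext x
    simp only [lowerSet, glue, mem_union, mem_ofPred_eq, mem_iUnion, exists_prop, centroid_eq]
    constructor
    · rintro (⟨ω, hω, rfl⟩ | ⟨ω, hω, hx⟩)
      · exact ⟨ω, by rw [if_neg hω]; exact mem_image_of_mem _ rfl⟩
      · exact ⟨ω, by rwa [if_pos hω]⟩
    · rintro ⟨ω, hx⟩
      by_cases hω : ω ∈ J
      · rw [if_pos hω] at hx
        exact Or.inr ⟨ω, hω, hx⟩
      · rw [if_neg hω, image_singleton] at hx
        exact Or.inl ⟨ω, hω, hx⟩
  ext α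
  constructor
  · rintro ⟨J, β, hJ, hβ, rfl⟩
    refine ⟨J, _, hJ, fun ω => ?_, hl J β⟩
    by_cases hω : ω ∈ J
    · simp only [if_pos hω]; exact mem_twoMeansSets.2 (hβ ω hω)
    · simp only [if_neg hω]; exact Finset.mem_singleton_self _
  · rintro ⟨J, β, hJ, hβ, rfl⟩
    refine ⟨J, β, hJ, fun ω hω => ?_, ?_⟩
    · have := hβ ω
      rw [if_pos hω] at this
      exact mem_twoMeansSets.1 this
    · rw [hl]
      congr 1
      funext ω
      by_cases hω : ω ∈ J
      · rw [if_pos hω]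
      · have := hβ ω
        rw [if_neg hω] at this ⊢
        exact Finset.mem_singleton.1 this

theorem upperFamily_eq (ℓ n : ℕ) :
    upperFamily ℓ n = glueFamily ℓ (n - 2 * 3 ^ ℓ) {threeMeans} twoMeansSets := by
  classical
  have hl : ∀ (J : Finset (Word ℓ)) (γ β : Word ℓ → Set Plane),
      upperSet J γ β = glue fun ω => if ω ∈ J then γ ω else β ω := by
    intro J γ β
    ext x
    simp only [upperSet, glue, mem_union, mem_iUnion, exists_prop]
    constructor
    · rintro (⟨ω, hω, hx⟩ | ⟨ω, hω, hx⟩)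
      · exact ⟨ω, by rwa [if_pos hω]⟩
      · exact ⟨ω, by rwa [if_neg hω]⟩
    · rintro ⟨ω, hx⟩
      by_cases hω : ω ∈ J
      · rw [if_pos hω] at hx
        exact Or.inl ⟨ω, hω, hx⟩
      · rw [if_neg hω] at hx
        exact Or.inr ⟨ω, hω, hx⟩
  ext α
  constructor
  · rintro ⟨J, γ, β, hJ, hγ, hβ, rfl⟩
    refine ⟨J, _, hJ, fun ω => ?_, hl J γ β⟩
    by_cases hω : ω ∈ J
    · simp only [if_pos hω]
      exact Finset.mem_singleton.2 ((isOptimalSet_three_iff _).1 (hγ ω hω))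
    · simp only [if_neg hω]; exact mem_twoMeansSets.2 (hβ ω hω)
  · rintro ⟨J, β, hJ, hβ, rfl⟩
    refine ⟨J, β, β, hJ, fun ω hω => ?_, fun ω hω => ?_, ?_⟩
    · have := hβ ω
      rw [if_pos hω] at this
      exact (isOptimalSet_three_iff _).2 (Finset.mem_singleton.1 this)
    · have := hβ ω
      rw [if_neg hω] at this
      exact mem_twoMeansSets.1 this
    · rw [hl]
      simp

theorem isOptimalSet_one : quantError rMeasure 1 = errorBound 0 1 ∧
    IsOptimalSet rMeasure 1 {center} :=
  isOptimalSet_of_le (singleton_nonempty _) (by simp) distortion_singleton_center.le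

theorem isOptimalSet_of_mem_lowerFamily {ℓ n : ℕ} (h₁ : 3 ^ ℓ ≤ n) (h₂ : n ≤ 2 * 3 ^ ℓ)
    {α : Set Plane} (hα : α ∈ lowerFamily ℓ n) :
    quantError rMeasure n = errorBound ℓ n ∧ IsOptimalSet rMeasure n α := by
  rw [lowerFamily_eq] at hα
  refine isOptimalSet_of_mem_glueFamily (fun s hs => mem_twoMeansSets.1 hs)
    (isOptimalSet_twoMeans 0).1 (fun s hs => ?_) isOptimalSet_one.1 (by omega) hα
  rw [Finset.mem_singleton.1 hs]
  exact isOptimalSet_one.2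

theorem isOptimalSet_of_mem_upperFamily {ℓ n : ℕ} (h₁ : 2 * 3 ^ ℓ ≤ n) (h₂ : n ≤ 3 * 3 ^ ℓ)
    {α : Set Plane} (hα : α ∈ upperFamily ℓ n) :
    quantError rMeasure n = errorBound ℓ n ∧ IsOptimalSet rMeasure n α := by
  rw [upperFamily_eq] at hα
  refine isOptimalSet_of_mem_glueFamily (fun s hs => ?_) quantError_three
    (fun s hs => mem_twoMeansSets.1 hs) (isOptimalSet_twoMeans 0).1 (by omega) hα
  rw [Finset.mem_singleton.1 hs]
  exact (isOptimalSet_three_iff _).2 rfl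

theorem subset_of_mem_twoMeansSets {s : Set Plane} (hs : s ∈ twoMeansSets) : s ⊆ triangle := by
  obtain ⟨k, rfl⟩ := (isOptimalSet_two_iff s).1 (mem_twoMeansSets.1 hs)
  exact twoMeans_subset k

theorem ncard_of_mem_twoMeansSets {s : Set Plane} (hs : s ∈ twoMeansSets) : s.ncard = 2 := by
  obtain ⟨k, rfl⟩ := (isOptimalSet_two_iff s).1 (mem_twoMeansSets.1 hs)
  exact ncard_twoMeans k

theorem ncard_lowerFamily (ℓ n : ℕ) :
    (lowerFamily ℓ n).ncard = (3 ^ ℓ).choose (n - 3 ^ ℓ) * 3 ^ (n - 3 ^ ℓ) := by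
  rw [lowerFamily_eq, ncard_glueFamily, card_twoMeansSets, Finset.card_singleton, one_pow, mul_one]
  · rw [Finset.disjoint_singleton_right]
    intro h
    simpa using ncard_of_mem_twoMeansSets h
  · exact fun s hs => subset_of_mem_twoMeansSets hs
  · intro s hs
    rw [Finset.mem_singleton.1 hs, singleton_subset_iff]
    exact center_mem_triangle

theorem ncard_upperFamily {ℓ n : ℕ} (h : 2 * 3 ^ ℓ ≤ n) :
    (upperFamily ℓ n).ncard =
      (3 ^ ℓ).choose (n - 2 * 3 ^ ℓ) * 3 ^ (3 ^ (ℓ + 1) - n) := by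
  rw [upperFamily_eq, ncard_glueFamily, card_twoMeansSets, Finset.card_singleton, one_pow, one_mul]
  · congr 2
    rw [pow_succ]
    omega
  · rw [Finset.disjoint_singleton_left]
    intro h
    have := ncard_of_mem_twoMeansSets h
    rw [ncard_threeMeans] at this
    norm_num at this
  · intro s hs
    rw [Finset.mem_singleton.1 hs]
    exact threeMeans_subset
  · exact fun s hs => subset_of_mem_twoMeansSets hs

theorem quantError_eq_errorBound {ℓ n : ℕ} (h₁ : 3 ^ ℓ ≤ n) (h₂ : n ≤ 3 * 3 ^ ℓ) :
    quantError rMeasure n = errorBound ℓ n := by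
  have hA : twoMeansSets.Nonempty := ⟨_, mem_twoMeansSets.2 (isOptimalSet_twoMeans 0).2⟩
  rcases le_total n (2 * 3 ^ ℓ) with h | h
  · obtain ⟨α, hα⟩ := glueFamily_nonempty (ℓ := ℓ) (j := n - 3 ^ ℓ) (by omega) hA
      (Finset.singleton_nonempty {center})
    rw [← lowerFamily_eq] at hα
    exact (isOptimalSet_of_mem_lowerFamily h₁ h hα).1
  · obtain ⟨α, hα⟩ := glueFamily_nonempty (ℓ := ℓ) (j := n - 2 * 3 ^ ℓ) (by omega)
      (Finset.singleton_nonempty threeMeans) hA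
    rw [← upperFamily_eq] at hα
    exact (isOptimalSet_of_mem_upperFamily h h₂ hα).1

end

end RTriangle

theorem theorem3p10 (n ℓ : ℕ) (hn : 3 ≤ n) (hl : 3 ^ ℓ ≤ n) (hu : n < 3 ^ (ℓ + 1)) :
    (n = 3 ^ ℓ → ∀ α : Set Plane,
      RTriangle.IsOptimalSet RTriangle.rMeasure n α ↔
        α = Set.range fun ω : RTriangle.Word ℓ => RTriangle.centroid ω) ∧
    (3 ^ ℓ < n → n ≤ 2 * 3 ^ ℓ →
      (∀ α ∈ RTriangle.lowerFamily ℓ n, RTriangle.IsOptimalSet RTriangle.rMeasure n α) ∧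
      (RTriangle.lowerFamily ℓ n).ncard = (3 ^ ℓ).choose (n - 3 ^ ℓ) * 3 ^ (n - 3 ^ ℓ)) ∧
    (2 * 3 ^ ℓ < n →
      (∀ α ∈ RTriangle.upperFamily ℓ n, RTriangle.IsOptimalSet RTriangle.rMeasure n α) ∧
      (RTriangle.upperFamily ℓ n).ncard =
        (3 ^ ℓ).choose (n - 2 * 3 ^ ℓ) * 3 ^ (3 ^ (ℓ + 1) - n)) ∧
    RTriangle.quantError RTriangle.rMeasure n =
      1 / 2 * (1 / 27 ^ (ℓ + 1)) * (13 * 3 ^ ℓ - 4 * (n : ℝ)) := by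
  have hu' : n ≤ 3 * 3 ^ ℓ := by rw [pow_succ] at hu; omega
  refine ⟨?_, fun h₁ h₂ => ⟨fun α hα =>
    (RTriangle.isOptimalSet_of_mem_lowerFamily hl h₂ hα).2, RTriangle.ncard_lowerFamily ℓ n⟩,
    fun h => ⟨fun α hα => (RTriangle.isOptimalSet_of_mem_upperFamily h.le hu' hα).2,
      RTriangle.ncard_upperFamily h.le⟩, ?_⟩
  · rintro rfl
    refine RTriangle.isOptimalSet_pow_iff ?_
    rintro rfl
    norm_num at hn
  · rw [RTriangle.quantError_eq_errorBound hl hu', RTriangle.errorBound_eq]
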